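/- Let $n\ge 2$ and let $Q_c^n$ be the simply connected $n$-dimensional space form of curvature $c\in\{0,1,-1\}$, i.e. $\mathbb R^n$ ($c=0$), the unit sphere $\mathbb S^n\subset\mathbb R^{n+1}$ ($c=1$), or the hyperbolic space $\mathbb H^n=\{x\in\mathbb L^{n+1} : \langle x,x\rangle=-1,\ x_{n+1}>0\}$ ($c=-1$), where $\mathbb L^{n+1}$ is $\mathbb R^{n+1}$ with the form $x_1y_1+\dots+x_ny_n-x_{n+1}y_{n+1}$. Endow $Q_c^n\times\mathbb R$ with the Riemannian product metric $\langle\,,\rangle=\langle\,,\rangle_{Q}+dt^2$; let $\langle\,,\rangle_L=\langle\,,\rangle_{Q}-dt^2$ be the Lorentzian product metric, and $\partial_t$ the unit vertical field. For an oriented hypersurface $\Sigma\subset Q_c^n\times\mathbb R$ with unit normal $N$ and shape operator $AX=-\overline\nabla_XN$, let $\xi$ be its height function (the restriction of the projection to $\mathbb R$) and $\theta=\langle N,\partial_t\rangle$ its angle function. $\Sigma$ is a *vertical helicoid* if $\xi$ has no critical points on $\Sigma$, $\theta$ is nonconstant, every horizontal section $\Sigma_t=\Sigma\cap(Q_c^n\times\{t\})$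 is a minimal hypersurface of $Q_c^n\times\{t\}$, and $\langle A\nabla\xi,\nabla\xi\rangle=0$ on $\Sigma$. A hypersurface is *spacelike* if $\langle\,,\rangle_L$ is positive definite on its tangent spaces; a spacelike hypersurface is *zero mean isocurved* if its mean curvatures with respect to $\langle\,,\rangle$ and to $\langle\,,\rangle_L$ both vanish identically. For a hypersurface $\Sigma_0\subset Q_c^n$, a one-parameter group $\{\Gamma_s\}_{s\in\mathbb R}$ of isometries of $Q_c^n$ and $a>0$, the *$a$-pitched twisting* of $\Sigma_0$ determined by $\{\Gamma_s\}$ is $\{(\Gamma_s(p),as) : p\in\Sigma_0,\ s\in\mathbb R\}\subset Q_c^n\times\mathbb R$. For $k>0$ and $s\in\mathbb R$ let $\Gamma_s(k)$ be the linear map of the ambient space ($\mathbb R^n$, $\mathbb R^{n+1}$ or $\mathbb L^{n+1}$, respectively) that rotates each of the coordinate planes $(x_1,x_2),(x_3,x_4),\dots$ by the angle $ks$; here the planes are those formed from the first $d$ coordinates, with $d=n,\,n+1,\,n$ for $c=0,1,-1$, and all remaining coordinates (including $x_d$ if $d$ is odd) are fixed. **Theorem.** For every $k>0$, $\{\Gamma_s(k)\}_{s\in\mathbb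 R}$ restricts to a one-parameter group of isometries of $Q_c^n$. There are a totally geodesic hypersurface $\Sigma_0\subset Q_c^n$ and a two-parameter family $\{\Sigma(a,k) : a,k>0\}$ of properly embedded vertical helicoids in $Q_c^n\times\mathbb R$ such that, for all $a,k>0$, $\Sigma(a,k)$ is the $a$-pitched twisting of $\Sigma_0$ determined by $\{\Gamma_s(k)\}_{s\in\mathbb R}$, and every horizontal section of $\Sigma(a,k)$ is of the form $L\times\{t\}$ with $L$ a totally geodesic hypersurface of $Q_c^n$. Furthermore, for every $a>0$ there is $k>0$ such that $\Sigma(a,k)$ contains a nonempty open subset that is spacelike and zero mean isocurved. -/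

import Mathlib

open scoped ContDiff Topology

noncomputable section

namespace Helicoid

/-! ## Submanifolds of a flat pseudo-Euclidean space

`E` is a finite-dimensional real vector space with a constant symmetric bilinear form
`G : E → E → ℝ`, and `P ⊆ E` is a submanifold on which `G` restricts to a nondegenerate metric.
The Levi-Civita connection of `P` is the tangential part of the flat derivative of `E`, hence
`G (∇_X N) Y = G (D_X N) Y` for all `Y` tangent to `P`. -/

section General

variable {E : Type*} [NormedAddCommGroup E] [NormedSpace ℝ E]

/-- The tangent space of `S` at `x`: generated by the velocities of smooth curves of `S` through
`x` (for an embedded submanifold these velocities already form a linear subspace). -/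
def tangentSpace (S : Set E) (x : E) : Submodule ℝ E :=
  Submodule.span ℝ {v | ∃ γ : ℝ → E, ContDiffAt ℝ ∞ γ 0 ∧ (∀ᶠ s in 𝓝 (0 : ℝ), γ s ∈ S) ∧
    γ 0 = x ∧ deriv γ 0 = v}

/-- `S` is an embedded smooth hypersurface of the submanifold `P`: locally it is the zero set in
`P` of a smooth function whose differential does not vanish on the tangent space of `P`. -/
def IsHypersurface (P S : Set E) : Prop :=
  S ⊆ P ∧ ∀ x ∈ S, ∃ (U : Set E) (f : E → ℝ), IsOpen U ∧ x ∈ U ∧ ContDiffOn ℝ ∞ f U ∧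
    S ∩ U = {y | y ∈ P ∧ y ∈ U ∧ f y = 0} ∧ ∃ v ∈ tangentSpace P x, fderiv ℝ f x v ≠ 0

/-- `S` is an embedded hypersurface of `P` and its inclusion into `P` is a proper map. -/
def IsProperlyEmbeddedHypersurface (P S : Set E) : Prop :=
  IsHypersurface P S ∧ ∃ h : S ⊆ P, IsProperMap (Set.inclusion h)

/-- `N` is a smooth normal field with `G(N,N) = ε` along the part of `S` that lies in the open
set `U`. The field is tangent to `P`, orthogonal to `S`, and given together with a smooth
extension to `U`. -/
def IsUnitNormalOn (G : E → E → ℝ) (ε : ℝ) (P S U : Set E) (N : E → E) : Prop :=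
  IsOpen U ∧ ContDiffOn ℝ ∞ N U ∧ ∀ x ∈ S, x ∈ U →
    N x ∈ tangentSpace P x ∧ G (N x) (N x) = ε ∧ ∀ X ∈ tangentSpace S x, G (N x) X = 0

/-- The second fundamental form `⟨A X, Y⟩ = -⟨∇_X N, Y⟩` at `x`, for `X`, `Y` tangent to the
hypersurface. -/
def secondForm (G : E → E → ℝ) (N : E → E) (x X Y : E) : ℝ :=
  -G (fderiv ℝ N x X) Y

/-- `A` is the shape operator of `S` at `x` with respect to the normal field `N`. -/
def IsShapeOperator (G : E → E → ℝ) (S : Set E) (N : E → E) (x : E)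
    (A : tangentSpace S x →ₗ[ℝ] tangentSpace S x) : Prop :=
  ∀ X Y : tangentSpace S x, G (A X) Y = secondForm G N x X Y

/-- The (non normalized) mean curvature `trace A` of `S` at `x` is `H`. -/
def HasMeanCurvatureAt (G : E → E → ℝ) (S : Set E) (N : E → E) (x : E) (H : ℝ) : Prop :=
  ∃ A : tangentSpace S x →ₗ[ℝ] tangentSpace S x,
    IsShapeOperator G S N x A ∧ LinearMap.trace ℝ _ A = H

/-- `S` is a minimal hypersurface of the Riemannian submanifold `(P, G)`. -/
def IsMinimalHypersurface (G : E → E → ℝ) (P S : Set E) : Prop :=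
  IsHypersurface P S ∧ ∀ x ∈ S, ∃ (U : Set E) (N : E → E), x ∈ U ∧
    IsUnitNormalOn G 1 P S U N ∧ HasMeanCurvatureAt G S N x 0

/-- `S` is a totally geodesic hypersurface of the Riemannian submanifold `(P, G)`: its second
fundamental form vanishes. -/
def IsTotallyGeodesicHypersurface (G : E → E → ℝ) (P S : Set E) : Prop :=
  IsHypersurface P S ∧ ∀ x ∈ S, ∃ (U : Set E) (N : E → E), x ∈ U ∧
    IsUnitNormalOn G 1 P S U N ∧
    ∀ X ∈ tangentSpace S x, ∀ Y ∈ tangentSpace S x, secondForm G N x X Y = 0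

/-- `φ` restricts to an isometry of the Riemannian submanifold `(P, G)`. -/
def IsIsometryOf (G : E → E → ℝ) (P : Set E) (φ : E → E) : Prop :=
  Set.BijOn φ P P ∧ (∃ U : Set E, IsOpen U ∧ P ⊆ U ∧ ContDiffOn ℝ ∞ φ U) ∧
    ∀ x ∈ P, ∀ X ∈ tangentSpace P x, ∀ Y ∈ tangentSpace P x,
      G (fderiv ℝ φ x X) (fderiv ℝ φ x Y) = G X Y

/-- `Γ` restricts to a (smooth) one-parameter group of isometries of `(P, G)`. -/
def IsOneParameterIsometryGroup (G : E → E → ℝ) (P : Set E) (Γ : ℝ → E → E) : Prop :=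
  (∀ s, IsIsometryOf G P (Γ s)) ∧ (∀ x ∈ P, Γ 0 x = x) ∧
    (∀ s t, ∀ x ∈ P, Γ (s + t) x = Γ s (Γ t x)) ∧
    ∃ U : Set E, IsOpen U ∧ P ⊆ U ∧
      ContDiffOn ℝ ∞ (fun z : ℝ × E => Γ z.1 z.2) (Set.univ ×ˢ U)

/-! ## Hypersurfaces of products `Q × ℝ`

In this part `Q ⊆ E` is a Riemannian submanifold with metric `g`. -/

/-- The Riemannian product metric `g + dt²`. -/
def riemProd (g : E → E → ℝ) (X Y : E × ℝ) : ℝ := g X.1 Y.1 + X.2 * Y.2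

/-- The Lorentzian product metric `g - dt²`. -/
def lorProd (g : E → E → ℝ) (X Y : E × ℝ) : ℝ := g X.1 Y.1 - X.2 * Y.2

/-- The product `Q × ℝ`. -/
def prodLine (Q : Set E) : Set (E × ℝ) := Q ×ˢ Set.univ

/-- The horizontal section `Q × {t}`. -/
def slice (Q : Set E) (t : ℝ) : Set (E × ℝ) := Q ×ˢ {t}

/-- The angle function `⟨N, ∂_t⟩`. -/
def angle (g : E → E → ℝ) (N : E × ℝ → E × ℝ) (x : E × ℝ) : ℝ := riemProd g (N x) (0, 1)

/-- `x` is a horizontal point of `S`, i.e. a critical point of the height function. -/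
def IsHorizontalPoint (S : Set (E × ℝ)) (x : E × ℝ) : Prop :=
  ∀ X ∈ tangentSpace S x, X.2 = 0

/-- `Z` is the gradient at `x` of the height function of `S`, with respect to `g + dt²`. -/
def IsHeightGradient (g : E → E → ℝ) (S : Set (E × ℝ)) (x Z : E × ℝ) : Prop :=
  Z ∈ tangentSpace S x ∧ ∀ X ∈ tangentSpace S x, riemProd g Z X = X.2

/-- `S` is an (embedded) vertical helicoid of `Q × ℝ`: an orientable hypersurface with no
horizontal points and nonconstant angle function, whose horizontal sections are minimal and such
that the gradient of the height function is an asymptotic direction. -/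
def IsVerticalHelicoid (g : E → E → ℝ) (Q : Set E) (S : Set (E × ℝ)) : Prop :=
  IsHypersurface (prodLine Q) S ∧ (∀ x ∈ S, ¬ IsHorizontalPoint S x) ∧
    (∀ t : ℝ, IsMinimalHypersurface (riemProd g) (slice Q t) (S ∩ slice Q t)) ∧
    ∃ (U : Set (E × ℝ)) (N : E × ℝ → E × ℝ), S ⊆ U ∧
      IsUnitNormalOn (riemProd g) 1 (prodLine Q) S U N ∧
      (∃ x ∈ S, ∃ y ∈ S, angle g N x ≠ angle g N y) ∧
      ∀ x ∈ S, ∃ Z, IsHeightGradient g S x Z ∧ secondForm (riemProd g) N x Z Z = 0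

/-- The Lorentzian metric is positive definite on `S`. -/
def IsSpacelike (g : E → E → ℝ) (S : Set (E × ℝ)) : Prop :=
  ∀ x ∈ S, ∀ X ∈ tangentSpace S x, X ≠ 0 → 0 < lorProd g X X

/-- `S` is a spacelike hypersurface of `Q × ℝ` whose Riemannian mean curvature `trace A` and
Lorentzian mean curvature `-trace A_L` are both equal to the function `H`. -/
def IsMeanIsocurvedWith (g : E → E → ℝ) (Q : Set E) (S : Set (E × ℝ)) (H : E × ℝ → ℝ) : Prop :=
  IsHypersurface (prodLine Q) S ∧ IsSpacelike g S ∧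
    ∃ (U : Set (E × ℝ)) (N NL : E × ℝ → E × ℝ), S ⊆ U ∧
      IsUnitNormalOn (riemProd g) 1 (prodLine Q) S U N ∧
      IsUnitNormalOn (lorProd g) (-1) (prodLine Q) S U NL ∧
      ∀ x ∈ S, HasMeanCurvatureAt (riemProd g) S N x (H x) ∧
        HasMeanCurvatureAt (lorProd g) S NL x (-H x)

/-- `S` is zero mean isocurved. -/
def IsZeroMeanIsocurved (g : E → E → ℝ) (Q : Set E) (S : Set (E × ℝ)) : Prop :=
  IsMeanIsocurvedWith g Q S (fun _ => 0)

/-- The `a`-pitched twisting of `S₀` determined by `Γ`. -/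
def pitchedTwisting (a : ℝ) (Γ : ℝ → E → E) (S₀ : Set E) : Set (E × ℝ) :=
  {z | ∃ p ∈ S₀, ∃ s : ℝ, z = (Γ s p, a * s)}

end General

/-! ## The simply connected space forms of curvature `0`, `1`, `-1` -/

/-- The three types of simply connected space forms. -/
inductive SpaceForm
  | euclidean
  | spherical
  | hyperbolic

/-- The dimension of the space in which the `n`-dimensional space form stands. -/
def ambDim : SpaceForm → ℕ → ℕ
  | .euclidean, n => n
  | .spherical, n => n + 1
  | .hyperbolic, n => n + 1

/-- The ambient coordinate space: `ℝ^n` for `ℝ^n`, `ℝ^{n+1}` for `S^n`, and the vector space of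
the Lorentz space `L^{n+1}` for `H^n`. -/
abbrev Amb (c : SpaceForm) (n : ℕ) : Type := Fin (ambDim c n) → ℝ

/-- The flat form of the ambient space: `∑ x_i y_i`, and in the hyperbolic case
`∑_{i<n} x_i y_i - x_n y_n` (coordinates are numbered from `0`). -/
def metric : (c : SpaceForm) → (n : ℕ) → Amb c n → Amb c n → ℝ
  | .euclidean, n => fun x y : Fin n → ℝ => ∑ i, x i * y i
  | .spherical, n => fun x y : Fin (n + 1) → ℝ => ∑ i, x i * y i
  | .hyperbolic, n => fun x y : Fin (n + 1) → ℝ =>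
      (∑ i : Fin n, x i.castSucc * y i.castSucc) - x (Fin.last n) * y (Fin.last n)

/-- The space form: `ℝ^n`, the unit sphere `S^n`, or the upper sheet `H^n` of the hyperboloid. -/
def Q : (c : SpaceForm) → (n : ℕ) → Set (Amb c n)
  | .euclidean, _ => Set.univ
  | .spherical, n => {x | metric .spherical n x x = 1}
  | .hyperbolic, n => {x : Fin (n + 1) → ℝ | metric .hyperbolic n x x = -1 ∧ 0 < x (Fin.last n)}

/-- The `j`-th coordinate of `x`, for an arbitrary natural number `j`. -/
def coord {m : ℕ} (x : Fin m → ℝ) (j : ℕ) : ℝ := if h : j < m then x ⟨j, h⟩ else 0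

/-- The block diagonal matrix acting on the first `d` coordinates by the `2 × 2` rotations of
angle `φ` in the coordinate planes `(0,1), (2,3), …` (the last of the `d` coordinates is fixed if
`d` is odd) and by the identity on the other coordinates. -/
def blockRotation (m d : ℕ) (φ : ℝ) (x : Fin m → ℝ) : Fin m → ℝ := fun i =>
  if 2 * (i.val / 2) + 1 < d then
    if i.val % 2 = 0 then Real.cos φ * x i - Real.sin φ * coord x (i.val + 1)
    else Real.sin φ * coord x (i.val - 1) + Real.cos φ * x i
  else x i

/-- The number of coordinates on which the rotation blocks are placed. -/
def rotDim : SpaceForm → ℕ → ℕ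
  | .euclidean, n => n
  | .spherical, n => n + 1
  | .hyperbolic, n => n

/-- The one-parameter group `s ↦ Γ_s(k)`. -/
def Gam (c : SpaceForm) (n : ℕ) (k s : ℝ) : Amb c n → Amb c n :=
  blockRotation (ambDim c n) (rotDim c n) (k * s)

end Helicoid

end

/-!
A smooth family of unit vectors `η t` sweeps out the hypersurface `B (η t) x = 0` of `Q × ℝ`,
whose horizontal sections are totally geodesic because their unit normals `η t` are constant. If
`η` is a geodesic of the unit quadric, then its acceleration is orthogonal to these sections, and
for both metrics `B ± dt²` the second fundamental form is, up to a factor, the symmetric product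
of the linear forms `dt` and `B (η' t) ·`. On the tangent spaces these forms are multiples of the
metric duals of two orthogonal vectors: the gradient of the height function, which is therefore an
asymptotic direction, and the gradient of the slope `B (η' t) x` along the horizontal section. So
both mean curvatures vanish. The hypersurface is spacelike where the slope exceeds `1` in absolute
value, which a fast enough motion of `η` achieves near a given point.

The twisting of the section `B e x = 0` by a linear group `Γ` is the sweep of `η t = Γ (t / a) e`.
The generator `J` of a block rotation satisfies `J³ = -J`, hence
`Γ s = 1 + sin s J + (1 - cos s) J²`, and `Γ s e` is a great circle when `e` is an axis of one of
the rotated planes.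
-/

noncomputable section

namespace Helicoid

section Tangent

variable {E F : Type*} [NormedAddCommGroup E] [NormedSpace ℝ E]
  [NormedAddCommGroup F] [NormedSpace ℝ F]

theorem fderiv_mem_tangentSpace {S : Set E} {T : Set F} {f : E → F} {x v : E}
    (hf : ContDiffAt ℝ ∞ f x) (hST : ∀ᶠ y in 𝓝 x, y ∈ S → f y ∈ T) (hv : v ∈ tangentSpace S x) :
    fderiv ℝ f x v ∈ tangentSpace T (f x) := by
  have hle : tangentSpace S x ≤ (tangentSpace T (f x)).comap (fderiv ℝ f x).toLinearMap := by
    refine Submodule.span_le.2 ?_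
    rintro _ ⟨γ, hγ, hγS, rfl, rfl⟩
    have hderiv : deriv (f ∘ γ) 0 = fderiv ℝ f (γ 0) (deriv γ 0) :=
      fderiv_comp_deriv 0 (hf.differentiableAt (by simp)) (hγ.differentiableAt (by simp))
    refine Submodule.subset_span ⟨f ∘ γ, hf.comp 0 hγ, ?_, rfl, hderiv⟩
    filter_upwards [hγS, hγ.continuousAt.eventually hST] with s hs hST using hST hs
  exact hle hv

theorem tangentSpace_le_of_eventually {S T : Set E} {x : E} (h : ∀ᶠ y in 𝓝 x, y ∈ S → y ∈ T) :
    tangentSpace S x ≤ tangentSpace T x := fun v hv => by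
  simpa using fderiv_mem_tangentSpace (f := id) contDiffAt_id h hv

theorem tangentSpace_inter_of_isOpen {S O : Set E} (hO : IsOpen O) {x : E} (hx : x ∈ O) :
    tangentSpace (S ∩ O) x = tangentSpace S x :=
  le_antisymm (tangentSpace_le_of_eventually (.of_forall fun _ hy => hy.1))
    (tangentSpace_le_of_eventually ((hO.eventually_mem hx).mono fun _ hyO hyS => ⟨hyS, hyO⟩))

theorem tangentSpace_le_ker_fderiv {S : Set E} {f : E → F} {x : E} (hf : DifferentiableAt ℝ f x)
    (hS : ∀ᶠ y in 𝓝 x, y ∈ S → f y = 0) :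
    tangentSpace S x ≤ LinearMap.ker (fderiv ℝ f x).toLinearMap := by
  refine Submodule.span_le.2 ?_
  rintro _ ⟨γ, hγ, hγS, rfl, rfl⟩
  have hderiv : deriv (f ∘ γ) 0 = fderiv ℝ f (γ 0) (deriv γ 0) :=
    fderiv_comp_deriv 0 hf (hγ.differentiableAt (by simp))
  have hzero : f ∘ γ =ᶠ[𝓝 0] fun _ => 0 := by
    filter_upwards [hγS, hγ.continuousAt.eventually hS] with s hs hS using hS hs
  simpa [hzero.deriv_eq] using hderiv.symm

/-- Near `x`, the set `P` is the zero set of the smooth submersion `f`. -/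
structure IsDefiningMapAt (f : E → F) (P : Set E) (x : E) : Prop where
  contDiffAt : ContDiffAt ℝ ∞ f x
  surjective : Function.Surjective (fderiv ℝ f x)
  eventually_mem_iff : ∀ᶠ y in 𝓝 x, (y ∈ P ↔ f y = 0)

/-- `P` is an embedded smooth submanifold near `x`: it has a local defining map with values in some
`ℝ^m`, where `m` is the codimension. -/
def IsSubmanifoldAt (P : Set E) (x : E) : Prop :=
  ∃ (m : ℕ) (f : E → Fin m → ℝ), IsDefiningMapAt f P x

-- With a right inverse `R` of the differential, correct the line `s ↦ x + s v` by `R (ψ s)`, where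
-- the implicit function `ψ` has vanishing derivative at `0`.
theorem exists_curve_of_fderiv_apply_eq_zero [FiniteDimensional ℝ F] {f : E → F} {x v : E}
    (hf : ContDiffAt ℝ ∞ f x) (hsurj : Function.Surjective (fderiv ℝ f x))
    (hv : fderiv ℝ f x v = 0) :
    ∃ γ : ℝ → E, ContDiffAt ℝ ∞ γ 0 ∧ (∀ᶠ s in 𝓝 0, f (γ s) = f x) ∧ γ 0 = x ∧
      deriv γ 0 = v := by
  obtain ⟨R, hR⟩ := (fderiv ℝ f x).exists_rightInverse_of_surjective
    (LinearMap.range_eq_top.2 hsurj)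
  have : CompleteSpace F := FiniteDimensional.complete ℝ F
  let L : ℝ × F →L[ℝ] E := (ContinuousLinearMap.toSpanSingleton ℝ v).coprod R
  let g : ℝ × F → F := fun p => f (x + L p)
  have hL0 : x + L (0, 0) = x := by simp [L]
  have hg : ContDiffAt ℝ ∞ g (0, 0) :=
    ContDiffAt.comp _ (by rwa [hL0]) (contDiffAt_const.add L.contDiff.contDiffAt)
  have hg' : fderiv ℝ g (0, 0) = (fderiv ℝ f x).comp L := by
    have hfd : HasFDerivAt f (fderiv ℝ f x) (x + L (0, 0)) := by
      rw [hL0]; exact (hf.differentiableAt (by simp)).hasFDerivAt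
    exact (hfd.comp (0, 0) (L.hasFDerivAt.const_add x)).fderiv
  have hinr : fderiv ℝ g (0, 0) ∘L .inr ℝ ℝ F = .id ℝ F := by
    ext y; simpa [hg', L] using DFunLike.congr_fun hR y
  have hinl : fderiv ℝ g (0, 0) ∘L .inl ℝ ℝ F = 0 := by
    ext; simp [hg', L, hv]
  have hinv : (fderiv ℝ g (0, 0) ∘L .inr ℝ ℝ F).IsInvertible :=
    hinr ▸ ⟨.refl ℝ F, rfl⟩
  let ψ : ℝ → F := hg.implicitFunction (by simp) hinv
  have hψ : ContDiffAt ℝ ∞ ψ 0 := hg.contDiffAt_implicitFunction (by simp) hinv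
  have hψ0 : ψ 0 = 0 := hg.implicitFunction_apply_self (by simp) hinv
  have hψ' : HasDerivAt ψ 0 0 := by
    simpa [hinl] using
      (hg.hasStrictFDerivAt_implicitFunction (by simp) hinv).hasFDerivAt.hasDerivAt
  refine ⟨fun s => x + L (s, ψ s), contDiffAt_const.add
    (L.contDiff.contDiffAt.comp 0 (contDiffAt_id.prodMk hψ)), ?_, by simp [hψ0, L], ?_⟩
  · simpa [g, hL0] using hg.eventually_apply_implicitFunction (by simp) hinv
  · simpa [L] using ((L.hasFDerivAt.comp_hasDerivAt 0
      ((hasDerivAt_id (0 : ℝ)).prodMk hψ')).const_add x).deriv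

theorem IsDefiningMapAt.mem_tangentSpace_iff [FiniteDimensional ℝ F] {f : E → F} {P : Set E}
    {x v : E} (h : IsDefiningMapAt f P x) (hx : x ∈ P) :
    v ∈ tangentSpace P x ↔ fderiv ℝ f x v = 0 := by
  constructor
  · exact fun hv => tangentSpace_le_ker_fderiv (h.contDiffAt.differentiableAt (by simp))
      (h.eventually_mem_iff.mono fun _ => Iff.mp) hv
  · intro hv
    obtain ⟨γ, hγ, hγf, rfl, hγ'⟩ :=
      exists_curve_of_fderiv_apply_eq_zero h.contDiffAt h.surjective hv
    refine Submodule.subset_span ⟨γ, hγ, ?_, rfl, hγ'⟩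
    filter_upwards [hγf, hγ.continuousAt.eventually h.eventually_mem_iff] with s hs hmem
    rw [hmem, hs, ← h.eventually_mem_iff.self_of_nhds]
    exact hx

theorem IsSubmanifoldAt.mem_tangentSpace_zeroSet_iff {P : Set E} {f : E → ℝ} {x v : E}
    (hP : IsSubmanifoldAt P x) (hx : x ∈ P) (hf : ContDiffAt ℝ ∞ f x) (hfx : f x = 0)
    (hf' : ∃ w ∈ tangentSpace P x, fderiv ℝ f x w ≠ 0) :
    v ∈ tangentSpace {y | y ∈ P ∧ f y = 0} x ↔ v ∈ tangentSpace P x ∧ fderiv ℝ f x v = 0 := by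
  obtain ⟨m, g, hg⟩ := hP
  obtain ⟨w, hw, hfw⟩ := hf'
  have hgw := (hg.mem_tangentSpace_iff hx).1 hw
  have hderiv : fderiv ℝ (fun y => (g y, f y)) x = (fderiv ℝ g x).prod (fderiv ℝ f x) :=
    (hg.contDiffAt.differentiableAt (by simp)).fderiv_prodMk (hf.differentiableAt (by simp))
  have hdef : IsDefiningMapAt (fun y => (g y, f y)) {y | y ∈ P ∧ f y = 0} x := by
    refine ⟨hg.contDiffAt.prodMk hf, ?_, ?_⟩
    · rintro ⟨p, r⟩
      obtain ⟨u, rfl⟩ := hg.surjective p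
      refine ⟨u + ((r - fderiv ℝ f x u) / fderiv ℝ f x w) • w, ?_⟩
      rw [hderiv]
      ext <;> simp [hgw, hfw]
    · filter_upwards [hg.eventually_mem_iff] with y hy
      simp [hy]
  rw [hdef.mem_tangentSpace_iff ⟨hx, hfx⟩, hg.mem_tangentSpace_iff hx, hderiv]
  simp

end Tangent

section Product

theorem slice_subset_prodLine {E : Type*} (P : Set E) (t : ℝ) : slice P t ⊆ prodLine P :=
  Set.prod_mono_right (Set.subset_univ _)

variable {E : Type*} [NormedAddCommGroup E] [NormedSpace ℝ E] {P : Set E} {x : E} {t : ℝ}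

theorem hasFDerivAt_comp_fst {F : Type*} [NormedAddCommGroup F] [NormedSpace ℝ F] {f : E → F}
    (hf : DifferentiableAt ℝ f x) :
    HasFDerivAt (fun z : E × ℝ => f z.1) ((fderiv ℝ f x).comp (.fst ℝ E ℝ)) (x, t) :=
  HasFDerivAt.comp (x, t) (f := Prod.fst) hf.hasFDerivAt hasFDerivAt_fst

theorem IsSubmanifoldAt.prodLine (h : IsSubmanifoldAt P x) :
    IsSubmanifoldAt (prodLine P) (x, t) := by
  obtain ⟨m, f, hf⟩ := h
  refine ⟨m, fun z => f z.1, ContDiffAt.comp (x, t) hf.contDiffAt contDiffAt_fst, ?_, ?_⟩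
  · rw [(hasFDerivAt_comp_fst (hf.contDiffAt.differentiableAt (by simp))).fderiv]
    exact hf.surjective.comp Prod.fst_surjective
  · filter_upwards [continuousAt_fst.eventually hf.eventually_mem_iff] with z hz
    simpa [Helicoid.prodLine] using hz

theorem fst_mem_tangentSpace_of_mem_prodLine {X : E × ℝ}
    (hX : X ∈ tangentSpace (prodLine P) (x, t)) : X.1 ∈ tangentSpace P x := by
  simpa [fderiv_fst] using! fderiv_mem_tangentSpace (f := Prod.fst) contDiffAt_fst
    (.of_forall fun z (hz : z ∈ prodLine P) => hz.1) hX

theorem mem_tangentSpace_slice {v : E} (hv : v ∈ tangentSpace P x) :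
    ((v, 0) : E × ℝ) ∈ tangentSpace (slice P t) (x, t) := by
  have hderiv : HasFDerivAt (fun y : E => (y, t)) (.inl ℝ E ℝ) x := hasFDerivAt_prodMk_left x t
  simpa [hderiv.fderiv] using! fderiv_mem_tangentSpace (f := fun y : E => (y, t))
    (contDiffAt_id.prodMk contDiffAt_const)
    (.of_forall fun y (hy : y ∈ P) => show (y, t) ∈ slice P t from ⟨hy, rfl⟩) hv

theorem mem_tangentSpace_slice_iff {X : E × ℝ} :
    X ∈ tangentSpace (slice P t) (x, t) ↔ X.1 ∈ tangentSpace P x ∧ X.2 = 0 := by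
  refine ⟨fun hX => ⟨?_, ?_⟩, fun ⟨h₁, h₂⟩ => ?_⟩
  · exact fst_mem_tangentSpace_of_mem_prodLine
      (tangentSpace_le_of_eventually (.of_forall (slice_subset_prodLine P t)) hX)
  · have hderiv : HasFDerivAt (fun z : E × ℝ => z.2 - t) (.snd ℝ E ℝ) (x, t) :=
      hasFDerivAt_snd.sub_const t
    simpa [hderiv.fderiv] using tangentSpace_le_ker_fderiv hderiv.differentiableAt
      (.of_forall fun z (hz : z ∈ slice P t) => sub_eq_zero.2 hz.2) hX
  · simpa [← h₂] using mem_tangentSpace_slice (t := t) h₁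

theorem mem_tangentSpace_prodLine_iff (hx : x ∈ P) {X : E × ℝ} :
    X ∈ tangentSpace (prodLine P) (x, t) ↔ X.1 ∈ tangentSpace P x := by
  refine ⟨fst_mem_tangentSpace_of_mem_prodLine, fun hX => ?_⟩
  have hhor : ((X.1, 0) : E × ℝ) ∈ tangentSpace (prodLine P) (x, t) :=
    tangentSpace_le_of_eventually (.of_forall (slice_subset_prodLine P t))
      (mem_tangentSpace_slice hX)
  have hver : ((0, X.2) : E × ℝ) ∈ tangentSpace (prodLine P) (x, t) := by
    have hderiv : HasDerivAt (fun s : ℝ => (x, t + s * X.2)) (0, X.2) 0 :=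
      (hasDerivAt_const _ _).prodMk (by
        simpa using ((hasDerivAt_id (0 : ℝ)).mul_const X.2).const_add t)
    refine Submodule.subset_span ⟨_, ?_, .of_forall fun s => ⟨hx, trivial⟩, ?_, hderiv.deriv⟩
    · fun_prop
    · simp
  simpa using Submodule.add_mem _ hhor hver

end Product

section Hypersurface

variable {E : Type*} [NormedAddCommGroup E] [NormedSpace ℝ E]

theorem isHypersurface_zeroSet {P : Set E} {f : E → ℝ} (hf : ContDiff ℝ ∞ f)
    (hf' : ∀ x ∈ P, f x = 0 → ∃ v ∈ tangentSpace P x, fderiv ℝ f x v ≠ 0) :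
    IsHypersurface P {x | x ∈ P ∧ f x = 0} :=
  ⟨fun _ hx => hx.1, fun x hx => ⟨Set.univ, f, isOpen_univ, trivial, hf.contDiffOn,
    by ext; simp, hf' x hx.1 hx.2⟩⟩

theorem isProperlyEmbeddedHypersurface_zeroSet {P : Set E} {f : E → ℝ} (hf : ContDiff ℝ ∞ f)
    (hf' : ∀ x ∈ P, f x = 0 → ∃ v ∈ tangentSpace P x, fderiv ℝ f x v ≠ 0) :
    IsProperlyEmbeddedHypersurface P {x | x ∈ P ∧ f x = 0} := by
  have hsub : {x | x ∈ P ∧ f x = 0} ⊆ P := fun _ hx => hx.1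
  have hclosed : IsClosed {x : P | f x = 0} :=
    isClosed_eq (hf.continuous.comp continuous_subtype_val) continuous_const
  refine ⟨isHypersurface_zeroSet hf hf', hsub, Topology.IsClosedEmbedding.isProperMap
    ⟨Topology.IsEmbedding.inclusion hsub, ?_⟩⟩
  convert hclosed
  ext x
  simp [Set.range_inclusion]

theorem IsHypersurface.inter_open {P S O : Set E} (h : IsHypersurface P S) (hO : IsOpen O) :
    IsHypersurface P (S ∩ O) := by
  refine ⟨fun x hx => h.1 hx.1, fun x hx => ?_⟩
  obtain ⟨U, f, hU, hxU, hf, hSU, hv⟩ := h.2 x hx.1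
  refine ⟨U ∩ O, f, hU.inter hO, ⟨hxU, hx.2⟩, hf.mono Set.inter_subset_left, ?_, hv⟩
  ext y
  have := Set.ext_iff.1 hSU y
  simp only [Set.mem_inter_iff, Set.mem_ofPred_eq] at this ⊢
  tauto

end Hypersurface

section Normalization

variable {E : Type*} [NormedAddCommGroup E] [NormedSpace ℝ E] {B : E →L[ℝ] E →L[ℝ] ℝ}
  {P S U : Set E} {N : E → E} {ε : ℝ} {x : E}

/-- The vector field `N` divided by its length `|B(N, N)|^{1/2}`; it is smooth only where `N` is not
`B`-isotropic. -/
def normalize (B : E →L[ℝ] E →L[ℝ] ℝ) (N : E → E) (x : E) : E :=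
  (√|B (N x) (N x)|)⁻¹ • N x

theorem contDiffAt_inv_sqrt_abs (hN : ContDiffAt ℝ ∞ N x) (hx : B (N x) (N x) ≠ 0) :
    ContDiffAt ℝ ∞ (fun y => (√|B (N y) (N y)|)⁻¹) x := by
  have hBN : ContDiffAt ℝ ∞ (fun y => B (N y) (N y)) x :=
    (B.contDiff.contDiffAt.comp x hN).clm_apply hN
  have habs : ContDiffAt ℝ ∞ (fun y => |B (N y) (N y)|) x :=
    ContDiffAt.comp x (contDiffAt_abs hx) hBN
  exact (habs.sqrt (abs_ne_zero.2 hx)).inv (Real.sqrt_ne_zero'.2 (abs_pos.2 hx))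

theorem isUnitNormalOn_normalize (hε : |ε| = 1) (hU : IsOpen U) (hN : ContDiffOn ℝ ∞ N U)
    (hpos : ∀ x ∈ U, 0 < ε * B (N x) (N x)) (htan : ∀ x ∈ S, N x ∈ tangentSpace P x)
    (horth : ∀ x ∈ S, ∀ X ∈ tangentSpace S x, B (N x) X = 0) :
    IsUnitNormalOn (fun X Y => B X Y) ε P S U (normalize B N) := by
  refine ⟨hU, fun x hx => ?_, fun x hxS hxU => ⟨Submodule.smul_mem _ _ (htan x hxS), ?_, ?_⟩⟩
  · have hNx := hN.contDiffAt (hU.mem_nhds hx)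
    exact ((contDiffAt_inv_sqrt_abs hNx (right_ne_zero_of_mul (hpos x hx).ne')).smul
      hNx).contDiffWithinAt
  · have habs : |B (N x) (N x)| = ε * B (N x) (N x) := by
      rw [← abs_of_pos (hpos x hxU), abs_mul, hε, one_mul]
    simp only [normalize, map_smul, smul_apply, smul_eq_mul, habs]
    rw [← mul_assoc, ← mul_inv, Real.mul_self_sqrt (hpos x hxU).le,
      inv_mul_eq_iff_eq_mul₀ (hpos x hxU).ne']
    rw [mul_right_comm, ← sq, ← sq_abs, hε, one_pow, one_mul]
  · intro X hX
    simp [normalize, horth x hxS X hX]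

theorem secondForm_normalize {X Y : E} (hN : ContDiffAt ℝ ∞ N x) (hx : B (N x) (N x) ≠ 0)
    (hY : B (N x) Y = 0) :
    secondForm (fun X Y => B X Y) (normalize B N) x X Y =
      (√|B (N x) (N x)|)⁻¹ * secondForm (fun X Y => B X Y) N x X Y := by
  have hderiv := ((contDiffAt_inv_sqrt_abs hN hx).differentiableAt (by simp)).hasFDerivAt.smul
    (hN.differentiableAt (by simp)).hasFDerivAt
  unfold secondForm
  rw [show fderiv ℝ (normalize B N) x = _ from hderiv.fderiv]
  simp [hY]

theorem hasMeanCurvatureAt_zero_of_secondForm_eq [FiniteDimensional ℝ E] {V W : E} (c : ℝ)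
    (hV : V ∈ tangentSpace S x) (hW : W ∈ tangentSpace S x) (hVW : B V W = 0) (hWV : B W V = 0)
    (h : ∀ X ∈ tangentSpace S x, ∀ Y ∈ tangentSpace S x,
      secondForm (fun X Y => B X Y) N x X Y = c * (B V X * B W Y + B W X * B V Y)) :
    HasMeanCurvatureAt (fun X Y => B X Y) S N x 0 := by
  let ι := (tangentSpace S x).subtype
  let A : tangentSpace S x →ₗ[ℝ] tangentSpace S x :=
    c • (((B V).toLinearMap ∘ₗ ι).smulRight ⟨W, hW⟩ + ((B W).toLinearMap ∘ₗ ι).smulRight ⟨V, hV⟩)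
  refine ⟨A, fun X Y => ?_, ?_⟩
  · rw [h X X.2 Y Y.2]
    simp [A, ι, mul_add]
  · simp [A, ι, LinearMap.trace_smulRight, hVW, hWV]

end Normalization

section HorizontalSection

variable {E : Type*} [NormedAddCommGroup E] [NormedSpace ℝ E] {B : E →L[ℝ] E →L[ℝ] ℝ}
  {P S : Set E} {t : ℝ}

theorem IsHypersurface.slice (h : IsHypersurface P S) :
    IsHypersurface (slice P t) (slice S t) := by
  refine ⟨Set.prod_mono_left h.1, ?_⟩
  rintro ⟨x, s⟩ ⟨hx, hs⟩
  obtain rfl : s = t := hs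
  obtain ⟨U, f, hU, hxU, hf, hSU, v, hv, hfv⟩ := h.2 x hx
  have hfx : DifferentiableAt ℝ f x :=
    (hf.contDiffAt (hU.mem_nhds hxU)).differentiableAt (by simp)
  refine ⟨U ×ˢ Set.univ, fun z => f z.1, hU.prod isOpen_univ, ⟨hxU, trivial⟩,
    hf.comp contDiffOn_fst fun z hz => hz.1, ?_, (v, 0), mem_tangentSpace_slice hv, ?_⟩
  · ext z
    have := Set.ext_iff.1 hSU z.1
    simp only [Helicoid.slice, Set.mem_inter_iff, Set.mem_prod, Set.mem_ofPred_eq] at this ⊢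
    tauto
  · simpa [(hasFDerivAt_comp_fst hfx).fderiv] using hfv

theorem IsTotallyGeodesicHypersurface.isMinimalHypersurface_slice
    (h : IsTotallyGeodesicHypersurface (fun X Y => B X Y) P S) :
    IsMinimalHypersurface (riemProd fun X Y => B X Y) (slice P t) (slice S t) := by
  refine ⟨h.1.slice, ?_⟩
  rintro ⟨x, s⟩ ⟨hx, hs⟩
  obtain rfl : s = t := hs
  obtain ⟨U, N, hxU, ⟨hU, hN, hunit⟩, hgeod⟩ := h.2 x hx
  refine ⟨U ×ˢ Set.univ, fun z => (N z.1, 0), ⟨hxU, trivial⟩, ⟨hU.prod isOpen_univ, ?_, ?_⟩,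
    0, ?_, map_zero _⟩
  · exact (hN.comp contDiffOn_fst fun z hz => hz.1).prodMk contDiffOn_const
  · rintro ⟨y, r⟩ ⟨hy, hr⟩ ⟨hyU, -⟩
    obtain rfl : r = s := hr
    obtain ⟨hNt, hNN, hNorth⟩ := hunit y hy hyU
    refine ⟨mem_tangentSpace_slice hNt, by simpa [riemProd] using hNN, fun X hX => ?_⟩
    simpa [riemProd] using hNorth _ (mem_tangentSpace_slice_iff.1 hX).1
  · rintro ⟨X, hX⟩ ⟨Y, hY⟩
    have hNx := (hN.contDiffAt (hU.mem_nhds hxU)).differentiableAt (by simp)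
    have hderiv : HasFDerivAt (fun z : E × ℝ => (N z.1, (0 : ℝ)))
        (((fderiv ℝ N x).comp (.fst ℝ E ℝ)).prod 0) (x, s) :=
      (hasFDerivAt_comp_fst hNx).prodMk (hasFDerivAt_const _ _)
    simpa [riemProd, secondForm, hderiv.fderiv] using hgeod _ (mem_tangentSpace_slice_iff.1 hX).1 _
      (mem_tangentSpace_slice_iff.1 hY).1

end HorizontalSection

section SpaceFormModel

variable {E : Type*} [NormedAddCommGroup E] [NormedSpace ℝ E] {B : E →L[ℝ] E →L[ℝ] ℝ} {κ : ℝ}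
  {Q : Set E} {η x v : E}

/-- `Q` is an open piece of the quadric `B(x, x) = 1/κ`, or an open subset of `E` if `κ = 0`, and
the symmetric form `B` is positive definite on its tangent spaces: a Riemannian manifold of constant
curvature `κ`. The equation is written `κ² B(x, x) = κ` in order to cover both cases. -/
structure IsSpaceFormModel (B : E →L[ℝ] E →L[ℝ] ℝ) (κ : ℝ) (Q : Set E) : Prop where
  symm : ∀ x y, B x y = B y x
  exists_isOpen : ∃ O : Set E, IsOpen O ∧ ∀ x, x ∈ Q ↔ x ∈ O ∧ κ ^ 2 * B x x = κ
  pos : ∀ x ∈ Q, ∀ v, κ * B x v = 0 → v ≠ 0 → 0 < B v v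

namespace IsSpaceFormModel

variable (hQ : IsSpaceFormModel B κ Q)
include hQ

theorem sq_mul_apply_self (hx : x ∈ Q) : κ ^ 2 * B x x = κ := by
  obtain ⟨O, -, hO⟩ := hQ.exists_isOpen
  exact ((hO x).1 hx).2

theorem eventually_mem_iff (hx : x ∈ Q) : ∀ᶠ y in 𝓝 x, (y ∈ Q ↔ κ ^ 2 * B y y = κ) := by
  obtain ⟨O, hO, hmem⟩ := hQ.exists_isOpen
  filter_upwards [hO.mem_nhds ((hmem x).1 hx).1] with y hy
  simp [hmem, hy]

theorem hasFDerivAt_equation (x : E) :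
    HasFDerivAt (fun y (_ : Fin 1) => κ ^ 2 * B y y - κ)
      (ContinuousLinearMap.pi fun _ => (2 * κ ^ 2) • B x) x := by
  refine hasFDerivAt_pi.2 fun _ => ?_
  refine (((B.hasFDerivAt.clm_apply (hasFDerivAt_id x)).const_mul (κ ^ 2)).sub_const
    κ).congr_fderiv ?_
  ext v
  simp only [ContinuousLinearMap.comp_id, id_eq, smul_add, add_apply, smul_apply, smul_eq_mul,
    ContinuousLinearMap.flip_apply, hQ.symm v x]
  ring

theorem isDefiningMapAt (hx : x ∈ Q) (hκ : κ ≠ 0) :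
    IsDefiningMapAt (fun y (_ : Fin 1) => κ ^ 2 * B y y - κ) Q x := by
  refine ⟨?_, fun p => ⟨(p 0 / (2 * κ)) • x, ?_⟩, ?_⟩
  · refine contDiffAt_pi.2 fun _ => ?_
    exact (contDiffAt_const.mul (B.contDiff.contDiffAt.clm_apply contDiffAt_id)).sub
      contDiffAt_const
  · ext i
    rw [(hQ.hasFDerivAt_equation x).fderiv, Subsingleton.elim i 0]
    simp only [ContinuousLinearMap.pi_apply, smul_apply, map_smul, smul_eq_mul]
    field_simp
    refine mul_left_cancel₀ hκ ?_
    linear_combination p 0 * hQ.sq_mul_apply_self hx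
  · filter_upwards [hQ.eventually_mem_iff hx] with y hy
    simp [hy, funext_iff, sub_eq_zero]

theorem isDefiningMapAt_of_eq_zero (hx : x ∈ Q) (hκ : κ = 0) :
    IsDefiningMapAt (fun _ => (0 : Fin 0 → ℝ)) Q x := by
  refine ⟨contDiffAt_const, Function.surjective_to_subsingleton _, ?_⟩
  filter_upwards [hQ.eventually_mem_iff hx] with y hy
  simp [hy, hκ]

theorem isSubmanifoldAt (hx : x ∈ Q) : IsSubmanifoldAt Q x := by
  by_cases hκ : κ = 0
  · exact ⟨0, _, hQ.isDefiningMapAt_of_eq_zero hx hκ⟩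
  · exact ⟨1, _, hQ.isDefiningMapAt hx hκ⟩

theorem mem_tangentSpace_iff (hx : x ∈ Q) : v ∈ tangentSpace Q x ↔ κ * B x v = 0 := by
  by_cases hκ : κ = 0
  · simp [(hQ.isDefiningMapAt_of_eq_zero hx hκ).mem_tangentSpace_iff hx, hκ]
  · rw [(hQ.isDefiningMapAt hx hκ).mem_tangentSpace_iff hx, (hQ.hasFDerivAt_equation x).fderiv]
    simp [hκ, funext_iff]

theorem sq_apply_le (hx : x ∈ Q) (hη : B η η = 1) (hxη : B x η = 0) (hxv : κ * B x v = 0) :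
    (B η v) ^ 2 ≤ B v v := by
  have hnonneg : 0 ≤ B (v - B η v • η) (v - B η v • η) := by
    rcases eq_or_ne (v - B η v • η) 0 with h | h
    · simp [h]
    · exact (hQ.pos x hx _ (by simp [hxη, hxv]) h).le
  simp only [map_sub, map_smul, sub_apply, smul_apply, smul_eq_mul, hη, hQ.symm v η] at hnonneg
  linarith

end IsSpaceFormModel

/-- The section of `Q` by the hyperplane `η^⊥` through the origin; for a unit vector `η` and a space
form model `Q` it is a totally geodesic hypersurface. -/
def hyperplaneSection (B : E →L[ℝ] E →L[ℝ] ℝ) (Q : Set E) (η : E) : Set E :=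
  {x | x ∈ Q ∧ B η x = 0}

theorem IsSpaceFormModel.isTotallyGeodesicHypersurface_hyperplaneSection
    (hQ : IsSpaceFormModel B κ Q) (hη : B η η = 1) :
    IsTotallyGeodesicHypersurface (fun X Y => B X Y) Q (hyperplaneSection B Q η) := by
  have htan : ∀ x ∈ hyperplaneSection B Q η, η ∈ tangentSpace Q x := fun x hx => by
    rw [hQ.mem_tangentSpace_iff hx.1, hQ.symm, hx.2, mul_zero]
  refine ⟨isHypersurface_zeroSet (B η).contDiff fun x hx hηx =>
    ⟨η, htan x ⟨hx, hηx⟩, by simp [hη]⟩, fun _ _ => ⟨Set.univ, fun _ => η, trivial,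
    ⟨isOpen_univ, contDiffOn_const, fun y hy _ => ⟨htan y hy, hη, fun X hX => ?_⟩⟩,
    fun X _ Y _ => by simp [secondForm]⟩⟩
  simpa using tangentSpace_le_ker_fderiv (B η).differentiableAt (.of_forall fun z hz => hz.2) hX

end SpaceFormModel

section Sweep

variable {E : Type*} [NormedAddCommGroup E] [NormedSpace ℝ E] {B : E →L[ℝ] E →L[ℝ] ℝ} {κ ε : ℝ}
  {Q : Set E} {η : ℝ → E} {z X Y : E × ℝ}

/-- `η` is a geodesic of the unit quadric `B(x, x) = 1`: its acceleration is normal to the quadric.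
The speed may be any real number. -/
structure IsUnitGeodesic (B : E →L[ℝ] E →L[ℝ] ℝ) (η : ℝ → E) : Prop where
  contDiff : ContDiff ℝ ∞ η
  apply_self : ∀ t, B (η t) (η t) = 1
  deriv_deriv : ∀ t, ∃ c : ℝ, deriv (deriv η) t = c • η t

theorem IsUnitGeodesic.contDiff_deriv (hη : IsUnitGeodesic B η) : ContDiff ℝ ∞ (deriv η) :=
  (contDiff_infty_iff_deriv.1 hη.contDiff).2

theorem IsUnitGeodesic.hasDerivAt (hη : IsUnitGeodesic B η) (t : ℝ) :
    HasDerivAt η (deriv η t) t :=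
  (hη.contDiff.differentiable (by simp) t).hasDerivAt

theorem IsUnitGeodesic.apply_deriv (hη : IsUnitGeodesic B η) (hB : ∀ x y, B x y = B y x) (t : ℝ) :
    B (η t) (deriv η t) = 0 := by
  have hderiv := (B.hasFDerivAt.comp_hasDerivAt t (hη.hasDerivAt t)).clm_apply (hη.hasDerivAt t)
  have hconst : (fun s => B (η s) (η s)) = fun _ => 1 := funext hη.apply_self
  have := hderiv.unique (hconst ▸ hasDerivAt_const t (1 : ℝ))
  simp only [hB (deriv η t), Function.comp_apply] at this
  linarith

theorem hasFDerivAt_apply_fst {γ : ℝ → E} {γ' : E} (hγ : HasDerivAt γ γ' z.2) :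
    HasFDerivAt (fun w : E × ℝ => B (γ w.2) w.1)
      ((B (γ z.2)).comp (.fst ℝ E ℝ) + (ContinuousLinearMap.snd ℝ E ℝ).smulRight (B γ' z.1)) z := by
  have hγz : HasFDerivAt (fun w : E × ℝ => γ w.2) _ z := hγ.hasFDerivAt.comp z hasFDerivAt_snd
  refine ((B.hasFDerivAt.comp z hγz).clm_apply hasFDerivAt_fst).congr_fderiv ?_
  ext <;> simp

theorem contDiff_apply_fst {γ : ℝ → E} (hγ : ContDiff ℝ ∞ γ) :
    ContDiff ℝ ∞ fun z : E × ℝ => B (γ z.2) z.1 :=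
  (B.contDiff.comp (hγ.comp contDiff_snd)).clm_apply contDiff_fst

/-- The hypersurface of `Q × ℝ` whose section at height `t` is the hyperplane section of `Q`
orthogonal to `η t`. -/
def hyperplaneSweep (B : E →L[ℝ] E →L[ℝ] ℝ) (Q : Set E) (η : ℝ → E) : Set (E × ℝ) :=
  {z | z ∈ prodLine Q ∧ B (η z.2) z.1 = 0}

/-- The slope of `hyperplaneSweep B Q η` at `z` with respect to the vertical direction: the vector
`(-sweepSlope B η z • η, 1)` is tangent to the sweep. -/
def sweepSlope (B : E →L[ℝ] E →L[ℝ] ℝ) (η : ℝ → E) (z : E × ℝ) : ℝ := B (deriv η z.2) z.1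

theorem hyperplaneSweep_inter_slice (t : ℝ) :
    hyperplaneSweep B Q η ∩ slice Q t = slice (hyperplaneSection B Q (η t)) t := by
  ext ⟨x, s⟩
  simp only [hyperplaneSweep, slice, prodLine, hyperplaneSection, Set.mem_inter_iff,
    Set.mem_ofPred_eq, Set.mem_prod, Set.mem_univ, Set.mem_singleton_iff]
  constructor
  · rintro ⟨⟨⟨hx, -⟩, hηx⟩, -, rfl⟩
    exact ⟨⟨hx, hηx⟩, rfl⟩
  · rintro ⟨⟨hx, hηx⟩, rfl⟩
    exact ⟨⟨⟨hx, trivial⟩, hηx⟩, hx, rfl⟩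

namespace IsSpaceFormModel

variable (hQ : IsSpaceFormModel B κ Q) (hη : IsUnitGeodesic B η)
include hQ hη

theorem exists_mem_tangentSpace_fderiv_ne_zero (hz : z ∈ prodLine Q) (hηz : B (η z.2) z.1 = 0) :
    ∃ X ∈ tangentSpace (prodLine Q) z, fderiv ℝ (fun w : E × ℝ => B (η w.2) w.1) z X ≠ 0 := by
  refine ⟨(η z.2, 0), (mem_tangentSpace_prodLine_iff hz.1).2 ?_, ?_⟩
  · rw [hQ.mem_tangentSpace_iff hz.1, hQ.symm, hηz, mul_zero]
  · simp [(hasFDerivAt_apply_fst (B := B) (hη.hasDerivAt z.2)).fderiv, hη.apply_self]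

theorem isProperlyEmbeddedHypersurface_hyperplaneSweep :
    IsProperlyEmbeddedHypersurface (prodLine Q) (hyperplaneSweep B Q η) :=
  isProperlyEmbeddedHypersurface_zeroSet (contDiff_apply_fst hη.contDiff) fun _ =>
    hQ.exists_mem_tangentSpace_fderiv_ne_zero hη

theorem mem_tangentSpace_hyperplaneSweep_iff (hz : z ∈ hyperplaneSweep B Q η) :
    X ∈ tangentSpace (hyperplaneSweep B Q η) z ↔
      κ * B z.1 X.1 = 0 ∧ B (η z.2) X.1 + X.2 * sweepSlope B η z = 0 := by
  have hP : IsSubmanifoldAt (prodLine Q) z := (hQ.isSubmanifoldAt hz.1.1).prodLine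
  refine (hP.mem_tangentSpace_zeroSet_iff hz.1 (contDiff_apply_fst hη.contDiff).contDiffAt hz.2
    (hQ.exists_mem_tangentSpace_fderiv_ne_zero hη hz.1 hz.2)).trans (and_congr ?_ ?_)
  · exact (mem_tangentSpace_prodLine_iff hz.1.1).trans (hQ.mem_tangentSpace_iff hz.1.1)
  · simp [(hasFDerivAt_apply_fst (B := B) (hη.hasDerivAt z.2)).fderiv, sweepSlope]

end IsSpaceFormModel

/-- The product form `B + ε dt²`: for `ε = 1` and `ε = -1` the bilinear versions of `riemProd` and
`lorProd`. -/
def prodForm (B : E →L[ℝ] E →L[ℝ] ℝ) (ε : ℝ) : (E × ℝ) →L[ℝ] (E × ℝ) →L[ℝ] ℝ :=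
  B.bilinearComp (.fst ℝ E ℝ) (.fst ℝ E ℝ) +
    ε • (ContinuousLinearMap.mul ℝ ℝ).bilinearComp (.snd ℝ E ℝ) (.snd ℝ E ℝ)

@[simp] theorem prodForm_apply : prodForm B ε X Y = B X.1 Y.1 + ε * (X.2 * Y.2) := rfl

theorem riemProd_eq_prodForm :
    riemProd (fun x y => B x y) = fun X Y => prodForm B 1 X Y := by
  ext; simp [riemProd]

theorem lorProd_eq_prodForm :
    lorProd (fun x y => B x y) = fun X Y => prodForm B (-1) X Y := by
  ext; simp [lorProd, sub_eq_add_neg]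

/-- The vector field dual, with respect to `B + ε dt²`, to the differential of the defining function
`(x, t) ↦ B (η t) x` of `hyperplaneSweep B Q η`. -/
def conormal (B : E →L[ℝ] E →L[ℝ] ℝ) (ε : ℝ) (η : ℝ → E) (z : E × ℝ) : E × ℝ :=
  (η z.2, ε * sweepSlope B η z)

theorem prodForm_conormal (hε : |ε| = 1) :
    prodForm B ε (conormal B ε η z) X = B (η z.2) X.1 + X.2 * sweepSlope B η z := by
  have hε' : ε ^ 2 = 1 := by rw [← sq_abs, hε, one_pow]
  simp only [prodForm_apply, conormal]
  linear_combination sweepSlope B η z * X.2 * hε'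

theorem mul_prodForm_conormal_self (hη : IsUnitGeodesic B η) (hε : |ε| = 1) :
    ε * prodForm B ε (conormal B ε η z) (conormal B ε η z) = ε + sweepSlope B η z ^ 2 := by
  have hε' : ε ^ 2 = 1 := by rw [← sq_abs, hε, one_pow]
  rw [prodForm_conormal hε]
  simp only [conormal, hη.apply_self]
  linear_combination sweepSlope B η z ^ 2 * hε'

theorem contDiff_sweepSlope (hη : IsUnitGeodesic B η) : ContDiff ℝ ∞ (sweepSlope B η) :=
  contDiff_apply_fst hη.contDiff_deriv

theorem contDiff_conormal (hη : IsUnitGeodesic B η) : ContDiff ℝ ∞ (conormal B ε η) :=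
  (hη.contDiff.comp contDiff_snd).prodMk (contDiff_const.mul (contDiff_sweepSlope hη))

-- The acceleration of `η` at height `z.2` is orthogonal to the section at that height, so the
-- second derivative of `η` does not enter.
theorem secondForm_conormal (hη : IsUnitGeodesic B η) (hε : |ε| = 1)
    (hz : z ∈ hyperplaneSweep B Q η) :
    secondForm (fun X Y => prodForm B ε X Y) (conormal B ε η) z X Y =
      -(X.2 * B (deriv η z.2) Y.1 + B (deriv η z.2) X.1 * Y.2) := by
  have hε' : ε ^ 2 = 1 := by rw [← sq_abs, hε, one_pow]
  obtain ⟨c, hc⟩ := hη.deriv_deriv z.2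
  have hslope := hasFDerivAt_apply_fst (B := B) (z := z)
    (hη.contDiff_deriv.differentiable (by simp) z.2).hasDerivAt
  have hηz : HasFDerivAt (fun w : E × ℝ => η w.2) _ z :=
    (hη.hasDerivAt z.2).hasFDerivAt.comp z hasFDerivAt_snd
  unfold secondForm
  rw [show fderiv ℝ (conormal B ε η) z = _ from (hηz.prodMk (hslope.const_mul ε)).fderiv]
  simp only [hc, map_smul, smul_apply, hz.2, smul_eq_mul, mul_zero,
    ContinuousLinearMap.smulRight_zero, add_zero, ContinuousLinearMap.prod_apply,
    ContinuousLinearMap.comp_apply, ContinuousLinearMap.coe_snd',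
    ContinuousLinearMap.toSpanSingleton_apply, ContinuousLinearMap.coe_fst', prodForm_apply]
  linear_combination -B (deriv η z.2) X.1 * Y.2 * hε'

theorem IsSpaceFormModel.conormal_mem_tangentSpace_prodLine (hQ : IsSpaceFormModel B κ Q)
    (hz : z ∈ hyperplaneSweep B Q η) : conormal B ε η z ∈ tangentSpace (prodLine Q) z :=
  (mem_tangentSpace_prodLine_iff hz.1.1).2 <| (hQ.mem_tangentSpace_iff hz.1.1).2 <| by
    rw [conormal, hQ.symm, hz.2, mul_zero]

/-- A tangent vector of `hyperplaneSweep B Q η` that is a multiple of the gradient of the height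
function for each of the metrics `B ± dt²`. -/
def ascent (B : E →L[ℝ] E →L[ℝ] ℝ) (η : ℝ → E) (z : E × ℝ) : E × ℝ :=
  (-sweepSlope B η z • η z.2, 1)

/-- The gradient of `sweepSlope B η` along the horizontal sections of `hyperplaneSweep B Q η`, which
is the projection of `deriv η` to the tangent spaces of `Q`. -/
def slopeGradient (B : E →L[ℝ] E →L[ℝ] ℝ) (κ : ℝ) (η : ℝ → E) (z : E × ℝ) : E × ℝ :=
  (deriv η z.2 - (κ * sweepSlope B η z) • z.1, 0)

namespace IsSpaceFormModel

variable (hQ : IsSpaceFormModel B κ Q) (hη : IsUnitGeodesic B η) (hz : z ∈ hyperplaneSweep B Q η)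
include hQ hη hz

theorem ascent_mem_tangentSpace : ascent B η z ∈ tangentSpace (hyperplaneSweep B Q η) z := by
  rw [hQ.mem_tangentSpace_hyperplaneSweep_iff hη hz]
  simp [ascent, hη.apply_self, hQ.symm z.1, hz.2]

theorem slopeGradient_mem_tangentSpace :
    slopeGradient B κ η z ∈ tangentSpace (hyperplaneSweep B Q η) z := by
  rw [hQ.mem_tangentSpace_hyperplaneSweep_iff hη hz]
  refine ⟨?_, by simp [slopeGradient, hη.apply_deriv hQ.symm, hz.2]⟩
  simp only [slopeGradient, map_sub, map_smul, smul_eq_mul, hQ.symm z.1 (deriv η z.2)]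
  rw [← sweepSlope]
  linear_combination -sweepSlope B η z * hQ.sq_mul_apply_self hz.1.1

theorem prodForm_ascent (hX : X ∈ tangentSpace (hyperplaneSweep B Q η) z) :
    prodForm B ε (ascent B η z) X = (ε + sweepSlope B η z ^ 2) * X.2 := by
  have hηX := ((hQ.mem_tangentSpace_hyperplaneSweep_iff hη hz).1 hX).2
  simp only [prodForm_apply, ascent, map_smul, smul_apply, smul_eq_mul]
  linear_combination -sweepSlope B η z * hηX

theorem prodForm_slopeGradient (hX : X ∈ tangentSpace (hyperplaneSweep B Q η) z) :
    prodForm B ε (slopeGradient B κ η z) X = B (deriv η z.2) X.1 := by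
  have hzX := ((hQ.mem_tangentSpace_hyperplaneSweep_iff hη hz).1 hX).1
  simp only [prodForm_apply, slopeGradient, map_smul, map_sub, sub_apply, smul_apply, smul_eq_mul]
  linear_combination -sweepSlope B η z * hzX

end IsSpaceFormModel

section UnitNormal

variable {O : Set (E × ℝ)} (hQ : IsSpaceFormModel B κ Q) (hη : IsUnitGeodesic B η)
include hQ hη

theorem IsSpaceFormModel.isUnitNormalOn_normalize_conormal (hε : |ε| = 1) (hO : IsOpen O)
    (hpos : ∀ z ∈ O, 0 < ε + sweepSlope B η z ^ 2) :
    IsUnitNormalOn (fun X Y => prodForm B ε X Y) ε (prodLine Q) (hyperplaneSweep B Q η ∩ O) O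
      (normalize (prodForm B ε) (conormal B ε η)) := by
  refine isUnitNormalOn_normalize hε hO (contDiff_conormal hη).contDiffOn (fun z hz => ?_)
    (fun z hz => hQ.conormal_mem_tangentSpace_prodLine hz.1) fun z hz X hX => ?_
  · rw [mul_prodForm_conormal_self hη hε]
    exact hpos z hz
  · rw [tangentSpace_inter_of_isOpen hO hz.2, hQ.mem_tangentSpace_hyperplaneSweep_iff hη hz.1] at hX
    rw [prodForm_conormal hε, hX.2]

theorem IsSpaceFormModel.secondForm_normalize_conormal (hε : |ε| = 1)
    (hz : z ∈ hyperplaneSweep B Q η) (hne : ε + sweepSlope B η z ^ 2 ≠ 0)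
    (hY : Y ∈ tangentSpace (hyperplaneSweep B Q η) z) :
    secondForm (fun X Y => prodForm B ε X Y) (normalize (prodForm B ε) (conormal B ε η)) z X Y =
      -(√|prodForm B ε (conormal B ε η z) (conormal B ε η z)|)⁻¹ *
        (X.2 * B (deriv η z.2) Y.1 + B (deriv η z.2) X.1 * Y.2) := by
  rw [← mul_prodForm_conormal_self hη hε] at hne
  rw [secondForm_normalize (contDiff_conormal hη).contDiffAt (right_ne_zero_of_mul hne),
    secondForm_conormal hη hε hz, mul_neg, neg_mul]
  rw [prodForm_conormal hε, ((hQ.mem_tangentSpace_hyperplaneSweep_iff hη hz).1 hY).2]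

-- The second fundamental form is a multiple of the symmetric product of two linear forms, namely
-- the metric duals of the orthogonal vectors `ascent` and `slopeGradient`.
theorem IsSpaceFormModel.hasMeanCurvatureAt_normalize_conormal [FiniteDimensional ℝ E]
    (hε : |ε| = 1) (hO : IsOpen O) (hz : z ∈ hyperplaneSweep B Q η ∩ O)
    (hne : ε + sweepSlope B η z ^ 2 ≠ 0) :
    HasMeanCurvatureAt (fun X Y => prodForm B ε X Y) (hyperplaneSweep B Q η ∩ O)
      (normalize (prodForm B ε) (conormal B ε η)) z 0 := by
  have hT := tangentSpace_inter_of_isOpen (S := hyperplaneSweep B Q η) hO hz.2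
  have hV := hQ.ascent_mem_tangentSpace hη hz.1
  have hW := hQ.slopeGradient_mem_tangentSpace hη hz.1
  refine hasMeanCurvatureAt_zero_of_secondForm_eq
    (-(√|prodForm B ε (conormal B ε η z) (conormal B ε η z)|)⁻¹ * (ε + sweepSlope B η z ^ 2)⁻¹)
    (hT ▸ hV) (hT ▸ hW) ?_ ?_ fun X hX Y hY => ?_
  · rw [hQ.prodForm_ascent hη hz.1 hW, slopeGradient, mul_zero]
  · rw [hQ.prodForm_slopeGradient hη hz.1 hV, ascent, map_smul, hQ.symm,
      hη.apply_deriv hQ.symm, smul_zero]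
  · rw [hT] at hX hY
    rw [hQ.secondForm_normalize_conormal hη hε hz.1 hne hY, hQ.prodForm_ascent hη hz.1 hX,
      hQ.prodForm_ascent hη hz.1 hY, hQ.prodForm_slopeGradient hη hz.1 hX,
      hQ.prodForm_slopeGradient hη hz.1 hY]
    field_simp

end UnitNormal

theorem angle_normalize_conormal_eq_zero_iff (hη : IsUnitGeodesic B η) :
    angle (fun x y => B x y) (normalize (prodForm B 1) (conormal B 1 η)) z = 0 ↔
      sweepSlope B η z = 0 := by
  have hpos : 0 < 1 * prodForm B 1 (conormal B 1 η z) (conormal B 1 η z) := by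
    rw [mul_prodForm_conormal_self hη abs_one]
    positivity
  have hne : √|prodForm B 1 (conormal B 1 η z) (conormal B 1 η z)| ≠ 0 :=
    Real.sqrt_ne_zero'.2 (abs_pos.2 (right_ne_zero_of_mul hpos.ne'))
  have hangle : angle (fun x y => B x y) (normalize (prodForm B 1) (conormal B 1 η)) z =
      (√|prodForm B 1 (conormal B 1 η z) (conormal B 1 η z)|)⁻¹ * sweepSlope B η z := by
    rw [angle, riemProd_eq_prodForm, normalize]
    simp [conormal]
  rw [hangle, mul_eq_zero, or_iff_right (inv_ne_zero hne)]

theorem IsSpaceFormModel.isHeightGradient_hyperplaneSweep (hQ : IsSpaceFormModel B κ Q)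
    (hη : IsUnitGeodesic B η) (hz : z ∈ hyperplaneSweep B Q η) :
    IsHeightGradient (fun x y => B x y) (hyperplaneSweep B Q η) z
      ((1 + sweepSlope B η z ^ 2)⁻¹ • ascent B η z) := by
  refine ⟨Submodule.smul_mem _ _ (hQ.ascent_mem_tangentSpace hη hz), fun X hX => ?_⟩
  have hne : 1 + sweepSlope B η z ^ 2 ≠ 0 := by positivity
  simp only [riemProd_eq_prodForm, map_smul, smul_apply, hQ.prodForm_ascent hη hz hX, smul_eq_mul,
    inv_mul_cancel_left₀ hne]

theorem IsSpaceFormModel.isVerticalHelicoid_hyperplaneSweep (hQ : IsSpaceFormModel B κ Q)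
    (hη : IsUnitGeodesic B η) {p q : E × ℝ} (hp : p ∈ hyperplaneSweep B Q η)
    (hpslope : sweepSlope B η p ≠ 0) (hq : q ∈ hyperplaneSweep B Q η)
    (hqslope : sweepSlope B η q = 0) :
    IsVerticalHelicoid (fun x y => B x y) Q (hyperplaneSweep B Q η) := by
  refine ⟨(hQ.isProperlyEmbeddedHypersurface_hyperplaneSweep hη).1, fun z hz hhor => ?_,
    fun t => ?_, Set.univ, normalize (prodForm B 1) (conormal B 1 η), Set.subset_univ _, ?_,
    ⟨p, hp, q, hq, ?_⟩, fun z hz => ⟨_, hQ.isHeightGradient_hyperplaneSweep hη hz, ?_⟩⟩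
  · exact one_ne_zero (hhor _ (hQ.ascent_mem_tangentSpace hη hz))
  · rw [hyperplaneSweep_inter_slice]
    exact (hQ.isTotallyGeodesicHypersurface_hyperplaneSection
      (hη.apply_self t)).isMinimalHypersurface_slice
  · rw [riemProd_eq_prodForm]
    simpa using hQ.isUnitNormalOn_normalize_conormal hη abs_one isOpen_univ
      fun z _ => by positivity
  · rwa [(angle_normalize_conormal_eq_zero_iff hη).2 hqslope, Ne,
      angle_normalize_conormal_eq_zero_iff hη]
  · have hasc : B (deriv η z.2) (ascent B η z).1 = 0 := by
      rw [ascent, map_smul, hQ.symm, hη.apply_deriv hQ.symm, smul_zero]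
    rw [riemProd_eq_prodForm, hQ.secondForm_normalize_conormal hη abs_one hz (by positivity)
      (hQ.isHeightGradient_hyperplaneSweep hη hz).1]
    simp [hasc]

theorem IsSpaceFormModel.lorProd_pos (hQ : IsSpaceFormModel B κ Q)
    (hη : IsUnitGeodesic B η) (hz : z ∈ hyperplaneSweep B Q η) (hslope : 1 < sweepSlope B η z ^ 2)
    (hX : X ∈ tangentSpace (hyperplaneSweep B Q η) z) (hX0 : X ≠ 0) :
    0 < lorProd (fun x y => B x y) X X := by
  obtain ⟨hzX, hηX⟩ := (hQ.mem_tangentSpace_hyperplaneSweep_iff hη hz).1 hX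
  rcases eq_or_ne X.2 0 with hX2 | hX2
  · have hX1 : X.1 ≠ 0 := fun hX1 => hX0 (Prod.ext hX1 hX2)
    simpa [lorProd, hX2] using hQ.pos z.1 hz.1.1 X.1 hzX hX1
  · have hcs : (X.2 * sweepSlope B η z) ^ 2 ≤ B X.1 X.1 := by
      rw [← neg_sq, ← eq_neg_of_add_eq_zero_left hηX]
      exact hQ.sq_apply_le hz.1.1 (hη.apply_self _) (by rw [hQ.symm, hz.2]) hzX
    have hlt : X.2 ^ 2 * 1 < X.2 ^ 2 * sweepSlope B η z ^ 2 := by gcongr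
    simp only [lorProd]
    linarith

theorem IsSpaceFormModel.isZeroMeanIsocurved_hyperplaneSweep_inter [FiniteDimensional ℝ E]
    (hQ : IsSpaceFormModel B κ Q) (hη : IsUnitGeodesic B η) {O : Set (E × ℝ)} (hO : IsOpen O)
    (hslope : ∀ z ∈ O, 1 < sweepSlope B η z ^ 2) :
    IsZeroMeanIsocurved (fun x y => B x y) Q (hyperplaneSweep B Q η ∩ O) := by
  have hneg : |(-1 : ℝ)| = 1 := by simp
  have hpos : ∀ z ∈ O, 0 < -1 + sweepSlope B η z ^ 2 := fun z hz => by linarith [hslope z hz]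
  refine ⟨(hQ.isProperlyEmbeddedHypersurface_hyperplaneSweep hη).1.inter_open hO,
    fun z hz X hX hX0 => ?_, O, normalize (prodForm B 1) (conormal B 1 η),
    normalize (prodForm B (-1)) (conormal B (-1) η), Set.inter_subset_right, ?_, ?_,
    fun z hz => ⟨?_, ?_⟩⟩
  · rw [tangentSpace_inter_of_isOpen hO hz.2] at hX
    exact hQ.lorProd_pos hη hz.1 (hslope z hz.2) hX hX0
  · rw [riemProd_eq_prodForm]
    exact hQ.isUnitNormalOn_normalize_conormal hη abs_one hO fun z _ => by positivity
  · rw [lorProd_eq_prodForm]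
    exact hQ.isUnitNormalOn_normalize_conormal hη hneg hO hpos
  · rw [riemProd_eq_prodForm]
    exact hQ.hasMeanCurvatureAt_normalize_conormal hη abs_one hO hz (by positivity)
  · rw [lorProd_eq_prodForm, neg_zero]
    exact hQ.hasMeanCurvatureAt_normalize_conormal hη hneg hO hz (hpos z hz.2).ne'

end Sweep

section IsometryGroup

variable {E : Type*} [NormedAddCommGroup E] [NormedSpace ℝ E] {B : E →L[ℝ] E →L[ℝ] ℝ} {Q : Set E}
  {Γ : ℝ → E →L[ℝ] E}

/-- `Γ` is a smooth one-parameter group of linear isometries of `(E, B)` that preserves `Q`. -/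
structure IsLinearIsometryGroup (B : E →L[ℝ] E →L[ℝ] ℝ) (Q : Set E) (Γ : ℝ → E →L[ℝ] E) :
    Prop where
  contDiff : ContDiff ℝ ∞ Γ
  map_zero : Γ 0 = 1
  map_add : ∀ s t, Γ (s + t) = Γ s * Γ t
  isometry : ∀ s x y, B (Γ s x) (Γ s y) = B x y
  mapsTo : ∀ s, Set.MapsTo (Γ s) Q Q

namespace IsLinearIsometryGroup

variable (hΓ : IsLinearIsometryGroup B Q Γ)
include hΓ

theorem comp_mul (k : ℝ) : IsLinearIsometryGroup B Q fun s => Γ (k * s) where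
  contDiff := hΓ.contDiff.comp (contDiff_const.mul contDiff_id)
  map_zero := by rw [mul_zero, hΓ.map_zero]
  map_add s t := by rw [mul_add, hΓ.map_add]
  isometry s := hΓ.isometry (k * s)
  mapsTo s := hΓ.mapsTo (k * s)

theorem apply_neg_apply (s : ℝ) (x : E) : Γ s (Γ (-s) x) = x := by
  rw [← mul_apply_eq_comp, ← hΓ.map_add, add_neg_cancel, hΓ.map_zero,
    one_apply_eq_self]

theorem bijOn (s : ℝ) : Set.BijOn (Γ s) Q Q := by
  refine Set.InvOn.bijOn (f' := Γ (-s)) ⟨fun x _ => ?_, fun x _ => hΓ.apply_neg_apply s x⟩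
    (hΓ.mapsTo s) (hΓ.mapsTo (-s))
  simpa using hΓ.apply_neg_apply (-s) x

theorem isOneParameterIsometryGroup :
    IsOneParameterIsometryGroup (fun x y => B x y) Q fun s => Γ s := by
  refine ⟨fun s => ⟨hΓ.bijOn s, ⟨Set.univ, isOpen_univ, Set.subset_univ Q,
    (Γ s).contDiff.contDiffOn⟩, fun x _ X _ Y _ => ?_⟩, fun x _ => by simp [hΓ.map_zero],
    fun s t x _ => by simp [hΓ.map_add], Set.univ, isOpen_univ, Set.subset_univ Q, ?_⟩
  · simpa using hΓ.isometry s X Y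
  · exact ((hΓ.contDiff.comp contDiff_fst).clm_apply contDiff_snd).contDiffOn

theorem pitchedTwisting_hyperplaneSection {a : ℝ} (ha : a ≠ 0) (e : E) :
    pitchedTwisting a (fun s => Γ s) (hyperplaneSection B Q e) =
      hyperplaneSweep B Q fun t => Γ (t / a) e := by
  ext ⟨x, t⟩
  constructor
  · rintro ⟨p, ⟨hp, hep⟩, s, hz⟩
    obtain ⟨rfl, rfl⟩ := Prod.ext_iff.1 hz
    refine ⟨⟨hΓ.mapsTo s hp, trivial⟩, ?_⟩
    simp only [mul_div_cancel_left₀ s ha, hΓ.isometry, hep]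
  · rintro ⟨⟨hx, -⟩, hex⟩
    refine ⟨Γ (-(t / a)) x, ⟨hΓ.mapsTo _ hx, ?_⟩, t / a, ?_⟩
    · rwa [← hΓ.isometry (t / a), hΓ.apply_neg_apply]
    · simp only [hΓ.apply_neg_apply, mul_div_cancel₀ t ha]

end IsLinearIsometryGroup

theorem IsUnitGeodesic.comp_mul {η : ℝ → E} (hη : IsUnitGeodesic B η) (w : ℝ) :
    IsUnitGeodesic B fun t => η (w * t) where
  contDiff := hη.contDiff.comp (contDiff_const.mul contDiff_id)
  apply_self t := hη.apply_self (w * t)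
  deriv_deriv t := by
    obtain ⟨c, hc⟩ := hη.deriv_deriv (w * t)
    have hderiv : deriv (fun t => η (w * t)) = fun t => w • deriv η (w * t) :=
      funext (deriv_comp_mul_left w η)
    refine ⟨w * w * c, ?_⟩
    rw [hderiv, deriv_fun_const_smul_field, deriv_comp_mul_left, hc, smul_smul, smul_smul,
      mul_assoc]

theorem sweepSlope_comp_mul (η : ℝ → E) (w : ℝ) (z : E × ℝ) :
    sweepSlope B (fun t => η (w * t)) z = w * sweepSlope B η (z.1, w * z.2) := by
  rw [sweepSlope, deriv_comp_mul_left, map_smul, smul_apply, smul_eq_mul, sweepSlope]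

theorem IsSpaceFormModel.isVerticalHelicoid_hyperplaneSweep_comp_mul {κ w : ℝ} {η : ℝ → E} {p q : E}
    (hQ : IsSpaceFormModel B κ Q) (hη : IsUnitGeodesic B η) (hw : w ≠ 0)
    (hp : p ∈ Q) (hηp : B (η 0) p = 0) (hpslope : B (deriv η 0) p ≠ 0)
    (hq : q ∈ Q) (hηq : B (η 0) q = 0) (hqslope : B (deriv η 0) q = 0) :
    IsVerticalHelicoid (fun x y => B x y) Q (hyperplaneSweep B Q fun t => η (w * t)) := by
  refine hQ.isVerticalHelicoid_hyperplaneSweep (hη.comp_mul w) (p := (p, 0)) (q := (q, 0))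
    ⟨⟨hp, trivial⟩, by simpa using hηp⟩ ?_ ⟨⟨hq, trivial⟩, by simpa using hηq⟩ ?_
  · rw [sweepSlope_comp_mul, mul_zero]
    exact mul_ne_zero hw hpslope
  · rw [sweepSlope_comp_mul, mul_zero, sweepSlope, hqslope, mul_zero]

-- The sweep is spacelike where its slope exceeds `1` in absolute value, so a fast enough motion of
-- `η` makes it spacelike around a given point with nonzero slope.
theorem IsSpaceFormModel.exists_isZeroMeanIsocurved_hyperplaneSweep_comp_mul
    [FiniteDimensional ℝ E] {κ : ℝ} {η : ℝ → E} {p : E} (hQ : IsSpaceFormModel B κ Q)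
    (hη : IsUnitGeodesic B η) (hp : p ∈ Q) (hηp : B (η 0) p = 0) (hpslope : B (deriv η 0) p ≠ 0) :
    ∃ w > 0, ∃ O : Set (E × ℝ), IsOpen O ∧
      ((hyperplaneSweep B Q fun t => η (w * t)) ∩ O).Nonempty ∧
      IsZeroMeanIsocurved (fun x y => B x y) Q ((hyperplaneSweep B Q fun t => η (w * t)) ∩ O) := by
  obtain ⟨w, hw, hwslope⟩ : ∃ w > 0, w * |B (deriv η 0) p| = 2 :=
    ⟨2 / |B (deriv η 0) p|, by positivity, div_mul_cancel₀ 2 (abs_ne_zero.2 hpslope)⟩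
  have hslope : sweepSlope B (fun t => η (w * t)) (p, 0) ^ 2 = 4 := by
    rw [sweepSlope_comp_mul, mul_zero, sweepSlope, mul_pow, ← sq_abs (B _ _), ← mul_pow, hwslope]
    norm_num
  have hO : IsOpen {z | 1 < sweepSlope B (fun t => η (w * t)) z ^ 2} :=
    isOpen_lt continuous_const ((contDiff_sweepSlope (hη.comp_mul w)).continuous.pow 2)
  refine ⟨w, hw, _, hO, ⟨(p, 0), ⟨⟨hp, trivial⟩, by simpa using hηp⟩, ?_⟩,
    hQ.isZeroMeanIsocurved_hyperplaneSweep_inter (hη.comp_mul w) hO fun z hz => hz⟩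
  rw [Set.mem_ofPred_eq, hslope]
  norm_num

end IsometryGroup

section Rodrigues

variable {A : Type*} [Ring A] [Algebra ℝ A] {J : A}

/-- Rodrigues' formula for the exponential `exp (φ J)` of an element `J` such that `J ^ 3 = -J`. -/
def rodrigues (J : A) (φ : ℝ) : A := 1 + Real.sin φ • J + (1 - Real.cos φ) • J ^ 2

theorem rodrigues_zero : rodrigues J 0 = 1 := by simp [rodrigues]

theorem rodrigues_add (hJ : J ^ 3 = -J) (φ ψ : ℝ) :
    rodrigues J (φ + ψ) = rodrigues J φ * rodrigues J ψ := by
  have h12 : J * J ^ 2 = -J := by rw [← pow_succ', hJ]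
  have h21 : J ^ 2 * J = -J := by rw [← pow_succ, hJ]
  have h22 : J ^ 2 * J ^ 2 = -J ^ 2 := by rw [← pow_add, pow_succ, hJ, neg_mul, ← sq]
  simp only [rodrigues, Real.sin_add, Real.cos_add, add_mul, mul_add, one_mul, mul_one,
    smul_mul_smul_comm, h12, h21, h22, ← sq]
  module

end Rodrigues

section RotationGroup

variable {E : Type*} [NormedAddCommGroup E] [NormedSpace ℝ E] {B : E →L[ℝ] E →L[ℝ] ℝ}
  {J : E →L[ℝ] E}

theorem rodrigues_apply (φ : ℝ) (x : E) :
    rodrigues J φ x = x + Real.sin φ • J x + (1 - Real.cos φ) • J (J x) := by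
  simp [rodrigues, sq]

theorem contDiff_rodrigues : ContDiff ℝ ∞ (rodrigues J) :=
  (contDiff_const.add (Real.contDiff_sin.smul contDiff_const)).add
    ((contDiff_const.sub Real.contDiff_cos).smul contDiff_const)

theorem apply_rodrigues_rodrigues (hJ : J ^ 3 = -J) (hskew : ∀ x y, B (J x) y = -B x (J y))
    (φ : ℝ) (x y : E) : B (rodrigues J φ x) (rodrigues J φ y) = B x y := by
  have hadj : B (rodrigues J φ x) (rodrigues J φ y) =
      B x (rodrigues J (-φ) (rodrigues J φ y)) := by
    rw [rodrigues_apply φ x, rodrigues_apply (-φ)]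
    simp only [map_add, map_smul, add_apply, smul_apply, hskew, neg_neg, Real.sin_neg,
      Real.cos_neg, neg_smul, map_neg, smul_neg]
  rw [hadj, ← mul_apply_eq_comp, ← rodrigues_add hJ, neg_add_cancel, rodrigues_zero,
    one_apply_eq_self]

theorem isLinearIsometryGroup_rodrigues {Q : Set E} (hJ : J ^ 3 = -J)
    (hskew : ∀ x y, B (J x) y = -B x (J y)) (hmaps : ∀ φ, Set.MapsTo ⇑(rodrigues J φ) Q Q) :
    IsLinearIsometryGroup B Q (rodrigues J) where
  contDiff := contDiff_rodrigues
  map_zero := rodrigues_zero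
  map_add := rodrigues_add hJ
  isometry := apply_rodrigues_rodrigues hJ hskew
  mapsTo := hmaps

theorem rodrigues_apply_of_apply_apply_eq_neg {e : E} (he : J (J e) = -e) (φ : ℝ) :
    rodrigues J φ e = Real.cos φ • e + Real.sin φ • J e := by
  rw [rodrigues_apply, he]
  module

theorem deriv_rodrigues_apply {e : E} (he : J (J e) = -e) :
    deriv (fun φ => rodrigues J φ e) = fun φ => rodrigues J φ (J e) := by
  have hJe : J (J (J e)) = -J e := by rw [he, map_neg]
  ext1 φ
  simp only [rodrigues_apply_of_apply_apply_eq_neg he,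
    rodrigues_apply_of_apply_apply_eq_neg hJe, he]
  refine ((((Real.hasDerivAt_cos φ).smul_const e).add
    ((Real.hasDerivAt_sin φ).smul_const (J e))).congr_deriv ?_).deriv
  module

theorem isUnitGeodesic_rodrigues (hJ : J ^ 3 = -J) (hskew : ∀ x y, B (J x) y = -B x (J y)) {e : E}
    (hee : B e e = 1) (he : J (J e) = -e) : IsUnitGeodesic B fun φ => rodrigues J φ e where
  contDiff := contDiff_rodrigues.clm_apply contDiff_const
  apply_self φ := by rw [apply_rodrigues_rodrigues hJ hskew, hee]
  deriv_deriv φ := by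
    have hJe : J (J (J e)) = -J e := by rw [he, map_neg]
    refine ⟨-1, ?_⟩
    rw [deriv_rodrigues_apply he, deriv_rodrigues_apply hJe]
    simp only [he, map_neg, neg_smul, one_smul]

end RotationGroup

section BlockRotation

variable {m d : ℕ} {w : Fin m → ℝ}

/-- The diagonal bilinear form `∑ i, w i * x i * y i`. -/
def diagForm (w : Fin m → ℝ) : (Fin m → ℝ) →L[ℝ] (Fin m → ℝ) →L[ℝ] ℝ :=
  ∑ i, w i • (ContinuousLinearMap.proj i : (Fin m → ℝ) →L[ℝ] ℝ).smulRight (.proj i)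

theorem diagForm_apply (x y : Fin m → ℝ) : diagForm w x y = ∑ i, w i * (x i * y i) := by
  simp [diagForm]

theorem diagForm_comm (x y : Fin m → ℝ) : diagForm w x y = diagForm w y x := by
  simp only [diagForm_apply, mul_comm (x _)]

theorem diagForm_single (i : Fin m) (x : Fin m → ℝ) :
    diagForm w (Pi.single i 1) x = w i * x i := by
  simp [diagForm_apply, Pi.single_apply]

theorem exists_diagForm_self_eq {i j l : Fin m} (hij : i ≠ j) (hil : i ≠ l) (hjl : j ≠ l)
    (r b : ℝ) :
    ∃ p : Fin m → ℝ, p i = 0 ∧ p j = r ∧ p l = b ∧ diagForm w p p = w j * r ^ 2 + w l * b ^ 2 := by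
  refine ⟨r • Pi.single j 1 + b • Pi.single l 1, by simp [hij, hil], by simp [hjl],
    by simp [hjl.symm], ?_⟩
  simp only [map_add, map_smul, add_apply, smul_apply, diagForm_single, smul_eq_mul,
    Pi.single_eq_same, Pi.single_eq_of_ne hjl, Pi.single_eq_of_ne hjl.symm]
  ring

/-- The other coordinate of the coordinate plane that contains the `i`-th axis, among the planes
`(0, 1), (2, 3), …` of the first `d` coordinates; `i` itself if there is no such plane. -/
def blockPartner (h : d ≤ m) (i : Fin m) : Fin m :=
  if hi : 2 * (i.val / 2) + 1 < d then ⟨i.val + 1 - 2 * (i.val % 2), by omega⟩ else i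

/-- The sign of the nonzero entry of the `i`-th row of `blockGenerator`, or `0` if that row
vanishes. -/
def blockSign (d i : ℕ) : ℝ :=
  if 2 * (i / 2) + 1 < d then if i % 2 = 0 then -1 else 1 else 0

theorem blockPartner_involutive (h : d ≤ m) : Function.Involutive (blockPartner h) := by
  intro i
  by_cases hi : 2 * (i.val / 2) + 1 < d
  · have hdiv : (i.val + 1 - 2 * (i.val % 2)) / 2 = i.val / 2 := by omega
    ext
    simp only [blockPartner, hi, hdiv, dif_pos]
    omega
  · simp [blockPartner, hi]

theorem blockSign_blockPartner (h : d ≤ m) (i : Fin m) :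
    blockSign d (blockPartner h i) = -blockSign d i := by
  by_cases hi : 2 * (i.val / 2) + 1 < d
  · have hdiv : (i.val + 1 - 2 * (i.val % 2)) / 2 = i.val / 2 := by omega
    simp only [blockPartner, blockSign, hi, hdiv, dif_pos, if_true]
    split_ifs <;> first | omega | norm_num
  · simp [blockPartner, blockSign, hi]

theorem blockSign_pow_three (i : ℕ) : blockSign d i ^ 3 = blockSign d i := by
  unfold blockSign
  split_ifs <;> norm_num

theorem blockSign_sq {i : ℕ} (hi : 2 * (i / 2) + 1 < d) : blockSign d i ^ 2 = 1 := by
  rw [blockSign, if_pos hi]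
  split_ifs <;> norm_num

theorem mul_blockSign (hw : ∀ i : Fin m, i.val < d → w i = 1) (i : Fin m) :
    w i * blockSign d i = blockSign d i := by
  unfold blockSign
  split_ifs with hi
  · rw [hw i (by omega), one_mul]
  · rw [hw i (by omega), one_mul]
  · rw [mul_zero]

/-- The infinitesimal generator of the one-parameter group `blockRotation m d`. -/
def blockGenerator (h : d ≤ m) : (Fin m → ℝ) →L[ℝ] (Fin m → ℝ) :=
  ContinuousLinearMap.pi fun i => blockSign d i • .proj (blockPartner h i)

theorem blockGenerator_apply (h : d ≤ m) (x : Fin m → ℝ) (i : Fin m) :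
    blockGenerator h x i = blockSign d i * x (blockPartner h i) := rfl

theorem blockGenerator_blockGenerator_apply (h : d ≤ m) (x : Fin m → ℝ) (i : Fin m) :
    blockGenerator h (blockGenerator h x) i = -(blockSign d i ^ 2 * x i) := by
  rw [blockGenerator_apply, blockGenerator_apply, blockSign_blockPartner, blockPartner_involutive h]
  ring

theorem blockGenerator_pow_three (h : d ≤ m) : blockGenerator h ^ 3 = -blockGenerator h := by
  ext x i
  change blockGenerator h (blockGenerator h (blockGenerator h x)) i = -blockGenerator h x i
  rw [blockGenerator_blockGenerator_apply, blockGenerator_apply, ← mul_assoc, ← pow_succ,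
    blockSign_pow_three]

theorem diagForm_blockGenerator (h : d ≤ m) (hw : ∀ i : Fin m, i.val < d → w i = 1)
    (x y : Fin m → ℝ) : diagForm w (blockGenerator h x) y = -diagForm w x (blockGenerator h y) := by
  simp only [diagForm_apply, blockGenerator_apply]
  calc ∑ i : Fin m, w i * (blockSign d i * x (blockPartner h i) * y i)
      = ∑ i : Fin m, blockSign d i * (x (blockPartner h i) * y i) :=
        Finset.sum_congr rfl fun i _ => by rw [mul_assoc, ← mul_assoc, mul_blockSign hw]
    _ = ∑ i : Fin m, blockSign d (blockPartner h i) * (x i * y (blockPartner h i)) := by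
        rw [← Equiv.sum_comp (blockPartner_involutive h).toPerm]
        simp only [Function.Involutive.coe_toPerm, blockPartner_involutive h _]
    _ = -∑ i : Fin m, w i * (x i * (blockSign d i * y (blockPartner h i))) := by
        rw [← Finset.sum_neg_distrib]
        refine Finset.sum_congr rfl fun i _ => ?_
        rw [blockSign_blockPartner]
        linear_combination x i * y (blockPartner h i) * mul_blockSign hw i

theorem coord_val (x : Fin m → ℝ) (i : Fin m) : coord x i = x i := dif_pos i.isLt

theorem blockRotation_eq_rodrigues (h : d ≤ m) (φ : ℝ) :
    blockRotation m d φ = ⇑(rodrigues (blockGenerator h) φ) := by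
  ext x i
  simp only [rodrigues_apply, Pi.add_apply, Pi.smul_apply, smul_eq_mul,
    blockGenerator_blockGenerator_apply]
  rw [blockGenerator_apply, blockRotation, blockSign]
  split_ifs with hi hmod
  · have hpartner : i.val + 1 = blockPartner h i := by simp [blockPartner, hi, hmod]
    rw [hpartner, coord_val]
    ring
  · have hpartner : i.val - 1 = blockPartner h i := by
      simp only [blockPartner, hi, dif_pos]
      omega
    rw [hpartner, coord_val]
    ring
  · ring

theorem blockGenerator_blockGenerator_single (h : d ≤ m) {i : Fin m}
    (hi : 2 * (i.val / 2) + 1 < d) :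
    blockGenerator h (blockGenerator h (Pi.single i 1)) = -Pi.single i 1 := by
  ext j
  rw [blockGenerator_blockGenerator_apply, Pi.neg_apply, neg_inj]
  rcases eq_or_ne j i with rfl | hji
  · rw [blockSign_sq hi, one_mul]
  · rw [Pi.single_eq_of_ne hji, mul_zero]

end BlockRotation

section SpaceForms

/-- The diagonal entries of `metric c n`. -/
def weight : (c : SpaceForm) → (n : ℕ) → Fin (ambDim c n) → ℝ
  | .euclidean, _ => fun _ => 1
  | .spherical, _ => fun _ => 1
  | .hyperbolic, n => fun i : Fin (n + 1) => if i = Fin.last n then -1 else 1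

theorem metric_eq_diagForm (c : SpaceForm) (n : ℕ) :
    metric c n = fun x y => diagForm (weight c n) x y := by
  ext x y
  rw [diagForm_apply]
  cases c with
  | euclidean | spherical => simp only [metric, weight, one_mul]; rfl
  | hyperbolic =>
    refine Eq.trans ?_ (Fin.sum_univ_castSucc (n := n) _).symm
    simp [metric, weight, (Fin.castSucc_lt_last _).ne, sub_eq_add_neg]

theorem metric_apply (c : SpaceForm) (n : ℕ) (x y : Amb c n) :
    metric c n x y = diagForm (weight c n) x y := by rw [metric_eq_diagForm]

/-- The sectional curvature of `Q c n`. -/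
def curvature : SpaceForm → ℝ
  | .euclidean => 0
  | .spherical => 1
  | .hyperbolic => -1

theorem sum_mul_self_pos {ι : Type*} [Fintype ι] {v : ι → ℝ} (hv : v ≠ 0) : 0 < ∑ i, v i * v i := by
  obtain ⟨i, hi⟩ := Function.ne_iff.1 hv
  exact Finset.sum_pos' (fun i _ => mul_self_nonneg _) ⟨i, Finset.mem_univ _, mul_self_pos.2 hi⟩

theorem metric_hyperbolic_pos {n : ℕ} {x v : Fin (n + 1) → ℝ}
    (hx : metric .hyperbolic n x x = -1) (hxv : metric .hyperbolic n x v = 0) (hv : v ≠ 0) :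
    0 < metric .hyperbolic n v v := by
  simp only [metric] at hx hxv ⊢
  have hcs := Finset.sum_mul_sq_le_sq_mul_sq Finset.univ (fun i : Fin n => x i.castSucc)
    fun i : Fin n => v i.castSucc
  simp only [pow_two (x _), pow_two (v _)] at hcs
  set D := ∑ i : Fin n, v i.castSucc * v i.castSucc
  set x' := x (Fin.last n)
  set v' := v (Fin.last n)
  have hD0 : 0 ≤ D := Finset.sum_nonneg fun i _ => mul_self_nonneg _
  rw [sub_eq_zero.1 hxv, eq_add_of_sub_eq hx] at hcs
  have hDle : D ≤ x' ^ 2 * (D - v' * v') := by linarith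
  by_contra! hle
  have hDzero : D = 0 :=
    hD0.antisymm' (hDle.trans (mul_nonpos_of_nonneg_of_nonpos (sq_nonneg _) hle))
  have hv'zero : v' = 0 := by
    have hx' : 0 < x' ^ 2 := by
      have : 0 ≤ ∑ i : Fin n, x i.castSucc * x i.castSucc :=
        Finset.sum_nonneg fun i _ => mul_self_nonneg _
      linarith
    rw [hDzero, mul_nonneg_iff_of_pos_left hx'] at hDle
    exact mul_self_eq_zero.1 (le_antisymm (by linarith) (mul_self_nonneg v'))
  refine hv (funext fun i => Fin.lastCases hv'zero (fun j => ?_) i)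
  exact mul_self_eq_zero.1 ((Finset.sum_eq_zero_iff_of_nonneg fun i _ => mul_self_nonneg _).1
    hDzero j (Finset.mem_univ j))

theorem isSpaceFormModel_Q (c : SpaceForm) (n : ℕ) :
    IsSpaceFormModel (diagForm (weight c n)) (curvature c) (Q c n) := by
  refine ⟨diagForm_comm, ?_, fun x hx v hxv hv => ?_⟩
  · simp only [← metric_apply]
    cases c with
    | euclidean => exact ⟨Set.univ, isOpen_univ, by simp [Q, curvature]⟩
    | spherical => exact ⟨Set.univ, isOpen_univ, by simp [Q, curvature]⟩
    | hyperbolic =>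
      refine ⟨{x : Fin (n + 1) → ℝ | 0 < x (Fin.last n)},
        isOpen_lt continuous_const (continuous_apply _), fun x => ?_⟩
      exact and_comm.trans (and_congr_right' (by simp [curvature]))
  · rw [← metric_apply] at hxv ⊢
    cases c with
    | euclidean | spherical => exact sum_mul_self_pos hv
    | hyperbolic => exact metric_hyperbolic_pos hx.1 (by simpa [curvature] using hxv) hv

theorem rotDim_le_ambDim (c : SpaceForm) (n : ℕ) : rotDim c n ≤ ambDim c n := by
  cases c <;> simp [rotDim, ambDim]

theorem le_rotDim (c : SpaceForm) (n : ℕ) : n ≤ rotDim c n := by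
  cases c <;> simp [rotDim]

theorem exists_fin_ambDim_lt (c : SpaceForm) {n : ℕ} (hn : 2 ≤ n) :
    ∃ i : Fin (ambDim c n), 2 * (i.val / 2) + 1 < n :=
  ⟨⟨0, (by omega : 0 < n).trans_le ((le_rotDim c n).trans (rotDim_le_ambDim c n))⟩,
    by dsimp only; omega⟩

theorem weight_eq_one (c : SpaceForm) (n : ℕ) (i : Fin (ambDim c n)) (hi : i.val < rotDim c n) :
    weight c n i = 1 := by
  cases c with
  | euclidean | spherical => rfl
  | hyperbolic => exact if_neg fun h => hi.ne (congrArg Fin.val h)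

/-- The generator of the one-parameter groups `Gam c n k`. -/
def generator (c : SpaceForm) (n : ℕ) : Amb c n →L[ℝ] Amb c n :=
  blockGenerator (rotDim_le_ambDim c n)

theorem Gam_eq_rodrigues (c : SpaceForm) (n : ℕ) (k : ℝ) :
    Gam c n k = fun s => ⇑(rodrigues (generator c n) (k * s)) :=
  funext fun s => blockRotation_eq_rodrigues (rotDim_le_ambDim c n) (k * s)

theorem mapsTo_rodrigues_generator (c : SpaceForm) (n : ℕ) (φ : ℝ) :
    Set.MapsTo ⇑(rodrigues (generator c n) φ) (Q c n) (Q c n) := by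
  intro x hx
  have hmetric : metric c n (rodrigues (generator c n) φ x) (rodrigues (generator c n) φ x) =
      metric c n x x := by
    simp only [metric_apply]
    exact apply_rodrigues_rodrigues (blockGenerator_pow_three _)
      (diagForm_blockGenerator _ (weight_eq_one c n)) φ x x
  cases c with
  | euclidean => trivial
  | spherical => exact hmetric.trans hx
  | hyperbolic =>
    have hlast : rodrigues (generator .hyperbolic n) φ x (Fin.last n) = x (Fin.last n) := by
      rw [generator, ← blockRotation_eq_rodrigues]
      exact if_neg (by simp only [rotDim, Fin.val_last]; omega)
    exact ⟨hmetric.trans hx.1, hlast ▸ hx.2⟩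

theorem isLinearIsometryGroup_rodrigues_generator (c : SpaceForm) (n : ℕ) :
    IsLinearIsometryGroup (diagForm (weight c n)) (Q c n) (rodrigues (generator c n)) :=
  isLinearIsometryGroup_rodrigues (blockGenerator_pow_three _)
    (diagForm_blockGenerator _ (weight_eq_one c n)) (mapsTo_rodrigues_generator c n)

theorem exists_mem_Q_apply_eq (c : SpaceForm) {n : ℕ} {i j : Fin (ambDim c n)} (hij : i ≠ j)
    (hi : i.val < n) (hj : j.val < n) {r : ℝ} (hr : r ^ 2 ≤ 1) :
    ∃ p ∈ Q c n, p i = 0 ∧ p j = r := by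
  have hlast {k : Fin (n + 1)} (hk : k.val < n) : k ≠ Fin.last n := fun h => hk.ne (h ▸ rfl)
  cases c with
  | euclidean => exact ⟨Pi.single j r, trivial, by simp [hij], by simp⟩
  | spherical =>
    obtain ⟨p, hpi, hpj, -, hp⟩ := exists_diagForm_self_eq (w := weight .spherical n) hij
      (hlast hi) (hlast hj) r √(1 - r ^ 2)
    refine ⟨p, (metric_apply _ _ p p).trans (hp.trans ?_), hpi, hpj⟩
    rw [Real.sq_sqrt (sub_nonneg.2 hr)]
    simp only [weight]
    ring
  | hyperbolic =>
    obtain ⟨p, hpi, hpj, hpl, hp⟩ := exists_diagForm_self_eq (w := weight .hyperbolic n) hij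
      (hlast hi) (hlast hj) r √(1 + r ^ 2)
    refine ⟨p, ⟨(metric_apply _ _ p p).trans (hp.trans ?_), by rw [hpl]; positivity⟩, hpi, hpj⟩
    rw [Real.sq_sqrt (by positivity)]
    simp only [weight, if_neg (hlast hj), if_true]
    ring

theorem isUnitGeodesic_rodrigues_generator (c : SpaceForm) {n : ℕ} {i : Fin (ambDim c n)}
    (hi : 2 * (i.val / 2) + 1 < rotDim c n) :
    IsUnitGeodesic (diagForm (weight c n))
      fun φ => rodrigues (generator c n) φ (Pi.single i 1) := by
  refine isUnitGeodesic_rodrigues (blockGenerator_pow_three _)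
    (diagForm_blockGenerator _ (weight_eq_one c n)) ?_ (blockGenerator_blockGenerator_single _ hi)
  rw [diagForm_single, weight_eq_one c n i (by omega), Pi.single_eq_same, one_mul]

theorem exists_mem_Q_diagForm_eq (c : SpaceForm) {n : ℕ} {i : Fin (ambDim c n)}
    (hi : 2 * (i.val / 2) + 1 < n) {r : ℝ} (hr : r ^ 2 ≤ 1) :
    ∃ p ∈ Q c n, diagForm (weight c n) (Pi.single i 1) p = 0 ∧
      diagForm (weight c n) (deriv (fun φ => rodrigues (generator c n) φ (Pi.single i 1)) 0) p =
        r := by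
  have hi' : 2 * (i.val / 2) + 1 < rotDim c n := hi.trans_le (le_rotDim c n)
  have hwi : weight c n i = 1 := weight_eq_one c n i (by omega)
  set j := blockPartner (rotDim_le_ambDim c n) i with hj
  have hjval : j.val = i.val + 1 - 2 * (i.val % 2) := by simp only [hj, blockPartner, hi', dif_pos]
  have hsign : blockSign (rotDim c n) i ^ 2 = 1 := blockSign_sq hi'
  obtain ⟨p, hp, hpi, hpj⟩ := exists_mem_Q_apply_eq c (i := i) (j := j)
    (Fin.ne_of_val_ne (by omega)) (by omega) (by omega)
    (r := -(blockSign (rotDim c n) i * r)) (by rw [neg_sq, mul_pow, hsign, one_mul]; exact hr)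
  refine ⟨p, hp, by rw [diagForm_single, hpi, mul_zero], ?_⟩
  rw [generator, deriv_rodrigues_apply (blockGenerator_blockGenerator_single _ hi')]
  simp only [rodrigues_zero, one_apply_eq_self]
  rw [diagForm_blockGenerator _ (weight_eq_one c n), diagForm_single, hwi, blockGenerator_apply,
    ← hj, hpj]
  linear_combination r * hsign

end SpaceForms

end Helicoid

end

open Helicoid in
theorem mainTheorem3_general {E : Type*} [NormedAddCommGroup E] [NormedSpace ℝ E]
    [FiniteDimensional ℝ E] {B : E →L[ℝ] E →L[ℝ] ℝ} {κ : ℝ} {Q : Set E} {Γ : ℝ → E →L[ℝ] E} {e : E}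
    (hQ : IsSpaceFormModel B κ Q) (hΓ : IsLinearIsometryGroup B Q Γ)
    (hη : IsUnitGeodesic B fun s => Γ s e)
    (hp : ∃ p ∈ Q, B e p = 0 ∧ B (deriv (fun s => Γ s e) 0) p ≠ 0)
    (hq : ∃ q ∈ Q, B e q = 0 ∧ B (deriv (fun s => Γ s e) 0) q = 0) :
    (∀ k : ℝ, IsOneParameterIsometryGroup (fun x y => B x y) Q fun s => Γ (k * s)) ∧
    ∃ (S₀ : Set E) (S : ℝ → ℝ → Set (E × ℝ)),
      IsTotallyGeodesicHypersurface (fun x y => B x y) Q S₀ ∧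
      (∀ a k : ℝ, 0 < a → 0 < k →
        S a k = pitchedTwisting a (fun s => Γ (k * s)) S₀ ∧
        IsProperlyEmbeddedHypersurface (prodLine Q) (S a k) ∧
        IsVerticalHelicoid (fun x y => B x y) Q (S a k) ∧
        ∀ t : ℝ, ∃ L : Set E, IsTotallyGeodesicHypersurface (fun x y => B x y) Q L ∧
          S a k ∩ slice Q t = L ×ˢ {t}) ∧
      ∀ a : ℝ, 0 < a → ∃ k : ℝ, 0 < k ∧ ∃ O : Set (E × ℝ), IsOpen O ∧ (S a k ∩ O).Nonempty ∧
        IsZeroMeanIsocurved (fun x y => B x y) Q (S a k ∩ O) := by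
  obtain ⟨p, hpQ, hep, hpslope⟩ := hp
  obtain ⟨q, hqQ, heq, hqslope⟩ := hq
  have he : Γ 0 e = e := by rw [hΓ.map_zero, one_apply_eq_self]
  refine ⟨fun k => (hΓ.comp_mul k).isOneParameterIsometryGroup, hyperplaneSection B Q e,
    fun a k => hyperplaneSweep B Q fun t => Γ (k / a * t) e,
    hQ.isTotallyGeodesicHypersurface_hyperplaneSection (he ▸ hη.apply_self 0),
    fun a k ha hk => ⟨?_, hQ.isProperlyEmbeddedHypersurface_hyperplaneSweep (hη.comp_mul _),
      hQ.isVerticalHelicoid_hyperplaneSweep_comp_mul hη (div_pos hk ha).ne' hpQ (he.symm ▸ hep)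
        hpslope hqQ (he.symm ▸ heq) hqslope,
      fun t => ⟨_,
        hQ.isTotallyGeodesicHypersurface_hyperplaneSection ((hη.comp_mul _).apply_self t),
        hyperplaneSweep_inter_slice t⟩⟩, fun a ha => ?_⟩
  · rw [(hΓ.comp_mul k).pitchedTwisting_hyperplaneSection ha.ne']
    simp only [mul_div_assoc', div_mul_eq_mul_div]
  · obtain ⟨w, hw, hO⟩ := hQ.exists_isZeroMeanIsocurved_hyperplaneSweep_comp_mul hη hpQ
      (he.symm ▸ hep) hpslope
    exact ⟨w * a, mul_pos hw ha, by simpa only [mul_div_cancel_right₀ w ha.ne'] using hO⟩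

theorem mainTheorem3 (c : Helicoid.SpaceForm) (n : ℕ) (hn : 2 ≤ n) :
    (∀ k : ℝ, 0 < k → Helicoid.IsOneParameterIsometryGroup (Helicoid.metric c n)
      (Helicoid.Q c n) (Helicoid.Gam c n k)) ∧
    ∃ (S₀ : Set (Helicoid.Amb c n)) (S : ℝ → ℝ → Set (Helicoid.Amb c n × ℝ)),
      Helicoid.IsTotallyGeodesicHypersurface (Helicoid.metric c n) (Helicoid.Q c n) S₀ ∧
      (∀ a k : ℝ, 0 < a → 0 < k →
        S a k = Helicoid.pitchedTwisting a (Helicoid.Gam c n k) S₀ ∧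
        Helicoid.IsProperlyEmbeddedHypersurface (Helicoid.prodLine (Helicoid.Q c n)) (S a k) ∧
        Helicoid.IsVerticalHelicoid (Helicoid.metric c n) (Helicoid.Q c n) (S a k) ∧
        ∀ t : ℝ, ∃ L : Set (Helicoid.Amb c n),
          Helicoid.IsTotallyGeodesicHypersurface (Helicoid.metric c n) (Helicoid.Q c n) L ∧
          S a k ∩ Helicoid.slice (Helicoid.Q c n) t = L ×ˢ {t}) ∧
      ∀ a : ℝ, 0 < a → ∃ k : ℝ, 0 < k ∧ ∃ O : Set (Helicoid.Amb c n × ℝ), IsOpen O ∧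
        (S a k ∩ O).Nonempty ∧
        Helicoid.IsZeroMeanIsocurved (Helicoid.metric c n) (Helicoid.Q c n) (S a k ∩ O) := by
  rw [Helicoid.metric_eq_diagForm]
  simp only [Helicoid.Gam_eq_rodrigues]
  obtain ⟨i, hi⟩ := Helicoid.exists_fin_ambDim_lt c hn
  obtain ⟨p, hpQ, hp, hpslope⟩ := Helicoid.exists_mem_Q_diagForm_eq c hi (one_pow 2).le
  have h := mainTheorem3_general (Helicoid.isSpaceFormModel_Q c n)
    (Helicoid.isLinearIsometryGroup_rodrigues_generator c n)
    (Helicoid.isUnitGeodesic_rodrigues_generator c (hi.trans_le (Helicoid.le_rotDim c n)))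
    ⟨p, hpQ, hp, hpslope.trans_ne one_ne_zero⟩
    (Helicoid.exists_mem_Q_diagForm_eq c hi (by norm_num))
  exact ⟨fun k _ => h.1 k, h.2⟩
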